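/- For $n\ge 1$ let $\mathrm{R}S_n$ be the (normalized) bar resolution of $\mathbb{Z}$ over $\mathbb{Z}S_n$: the chain complex with $\mathbb{Z}$-basis the symbols $g[a_1|\dots|a_k]$ in dimension $k\ge 0$ ($g,a_i\in S_n$, $a_i\ne 1$; a symbol in which some $a_i=1$ is $0$), left action $h\cdot g[a_1|\dots|a_k]=(hg)[a_1|\dots|a_k]$, augmentation $\epsilon(g[\,])=1$ (and $\epsilon=0$ in positive dimensions), and differential $$\partial\, g[a_1|\dots|a_k]=ga_1[a_2|\dots|a_k]+\sum_{i=1}^{k-1}(-1)^i g[a_1|\dots|a_ia_{i+1}|\dots|a_k]+(-1)^k g[a_1|\dots|a_{k-1}].$$ Let $A(S_n,1)\subset \mathrm{R}S_n$ be the subgroup spanned by all $1[a_1|\dots|a_k]$. An operad $\mathscr U=\{\mathscr U_n\}_{n\ge1}$ consists of $\mathbb{Z}$-free chain complexes $\mathscr U_n$ with left $S_n$-actions by chain maps, a unit $1\in(\mathscr U_1)_0$ and chain maps $\circ_i:\mathscr U_n\otimes\mathscr U_m\to\mathscr U_{n+m-1}$ ($1\le i\le m$) such that, for $a\in\mathscr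 U_n$, $b\in\mathscr U_m$, $c\in\mathscr U_t$: * (associativity) $(a\circ_i b)\circ_j c=a\circ_{i+j-1}(b\circ_j c)$; * (commutativity) $a\circ_{i+m-1}(b\circ_j c)=(-1)^{\dim a\,\dim b}\,b\circ_j(a\circ_i c)$ for $j<i$ and homogeneous $a,b$; * (equivariance) $a\circ_{\sigma(i)}(\sigma b)=T_{n,i}(\sigma)(a\circ_i b)$ and $(\tau a)\circ_i b=(1\oplus\dots\oplus\tau\oplus\dots\oplus1)(a\circ_i b)$ for $\sigma\in S_m$, $\tau\in S_n$, where $T_{n,i}(\sigma)\in S_{n+m-1}$ permutes $m$ consecutive blocks, the $i$-th of length $n$ and the others of length $1$, by moving the $j$-th block (in order) to the $\sigma(j)$-th place, and $\tau$ in the block sum acts on the $i$-th block; * (units) $1\circ_i b=b$ and $a\circ_1 1=a$. It is an $E_\infty$-operad if each $\mathscr U_n$ is a $\mathbb{Z}S_n$-free resolution of $\mathbb{Z}$. The tensor product $\mathscr U\otimes\mathscr V$ has components $\mathscr U_n\otimes\mathscr V_n$ with diagonal actions, unit $1\otimes1$, and $(a\otimes b)\circ_i(c\otimes d)=(-1)^{\dim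 b\,\dim c}(a\circ_i c)\otimes(b\circ_i d)$. A morphism of operads is a sequence of chain maps preserving actions, unit and compositions. **Theorem.** There is exactly one family of chain maps $\circ_i:\mathrm{R}S_n\otimes\mathrm{R}S_m\to\mathrm{R}S_{n+m-1}$ ($n,m\ge1$, $1\le i\le m$) that preserves augmentations ($\epsilon(a\circ_i b)=\epsilon(a)\epsilon(b)$), satisfies the two equivariance conditions, and satisfies $A(S_n,1)\circ_i A(S_m,1)\subseteq A(S_{n+m-1},1)$. With these compositions and the unit $[\,]\in\mathrm{R}S_1$, the sequence $\mathfrak S=\{\mathrm{R}S_n\}_{n\ge1}$ is an $E_\infty$-operad. Moreover $\mathfrak S$ is an operad-coalgebra: the maps $$\Delta(g[a_1|\dots|a_k])=\sum_{i=0}^{k} g[a_1|\dots|a_i]\otimes g a_1\cdots a_i[a_{i+1}|\dots|a_k]$$ form a coassociative morphism of operads $\Delta:\mathfrak S\to\mathfrak S\otimes\mathfrak S$. -/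

import Mathlib

open scoped TensorProduct DirectSum

noncomputable section

/-! ## Differential graded modules -/

section DG

variable {R : Type} [CommRing R]

/-- A differential graded module over `R` (a chain complex of `R`-modules concentrated in
non-negative dimensions), given by its total module, the submodules `gr k` of elements of
dimension `k`, and the differential `d` of degree `-1`. -/
structure DGModule (R : Type) [CommRing R] where
  carrier : Type
  [addCommGroup : AddCommGroup carrier]
  [module : Module R carrier]
  gr : ℕ → Submodule R carrier
  [decomposition : DirectSum.Decomposition gr]
  d : carrier →ₗ[R] carrier
  d_mem : ∀ k, ∀ x ∈ gr (k + 1), d x ∈ gr k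
  d_zero : ∀ x ∈ gr 0, d x = 0
  d_d : ∀ x, d (d x) = 0

attribute [instance] DGModule.addCommGroup DGModule.module DGModule.decomposition

namespace DGModule

/-- The linear map out of `C` which is `f k` on elements of dimension `k`. -/
def byDegree (C : DGModule R) {M : Type} [AddCommGroup M] [Module R M]
    (f : ℕ → C.carrier →ₗ[R] M) : C.carrier →ₗ[R] M :=
  DirectSum.toModule R ℕ M (fun k => f k ∘ₗ (C.gr k).subtype) ∘ₗ
    (DirectSum.decomposeLinearEquiv C.gr).toLinearMap

theorem byDegree_of_mem (C : DGModule R) {M : Type} [AddCommGroup M] [Module R M]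
    (f : ℕ → C.carrier →ₗ[R] M) {k : ℕ} {x : C.carrier} (hx : x ∈ C.gr k) :
    C.byDegree f x = f k x := by
  lift x to C.gr k using hx
  simp [byDegree]

/-- The sign operator `x ↦ (-1) ^ dim x • x`. -/
def sgn (C : DGModule R) : C.carrier →ₗ[R] C.carrier :=
  C.byDegree fun k => (-1 : R) ^ k • LinearMap.id

theorem sgn_of_mem (C : DGModule R) {k : ℕ} {x : C.carrier} (hx : x ∈ C.gr k) :
    C.sgn x = (-1 : R) ^ k • x := by
  rw [sgn, C.byDegree_of_mem _ hx]; rfl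

/-- The transposition `C ⊗ D → D ⊗ C`, `c ⊗ d ↦ (-1) ^ (dim c * dim d) • d ⊗ c`. -/
def swap (C D : DGModule R) : C.carrier ⊗[R] D.carrier →ₗ[R] D.carrier ⊗[R] C.carrier :=
  TensorProduct.lift <| C.byDegree fun p => LinearMap.flip <| D.byDegree fun q =>
    (-1 : R) ^ (p * q) • TensorProduct.mk R D.carrier C.carrier

theorem swap_tmul (C D : DGModule R) {p q : ℕ} {x : C.carrier} {y : D.carrier}
    (hx : x ∈ C.gr p) (hy : y ∈ D.gr q) :
    swap C D (x ⊗ₜ y) = (-1 : R) ^ (p * q) • (y ⊗ₜ[R] x) := by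
  rw [swap, TensorProduct.lift.tmul, C.byDegree_of_mem _ hx, LinearMap.flip_apply,
    D.byDegree_of_mem _ hy]
  rfl

/-- Elements of dimension `k` of `C ⊗ D`: sums of `x ⊗ y` with `dim x + dim y = k`. -/
def tensorGr (C D : DGModule R) (k : ℕ) : Submodule R (C.carrier ⊗[R] D.carrier) :=
  Submodule.span R {z | ∃ p q, p + q = k ∧ ∃ x ∈ C.gr p, ∃ y ∈ D.gr q, x ⊗ₜ[R] y = z}

theorem tmul_mem (C D : DGModule R) {p q k : ℕ} (h : p + q = k) {x : C.carrier} {y : D.carrier}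
    (hx : x ∈ C.gr p) (hy : y ∈ D.gr q) : x ⊗ₜ[R] y ∈ tensorGr C D k :=
  Submodule.subset_span ⟨p, q, h, x, hx, y, hy, rfl⟩

/-- The map `gr p × gr q → gr (p + q)` of the tensor product. -/
def tensorOf (C D : DGModule R) (p q : ℕ) : C.gr p →ₗ[R] D.gr q →ₗ[R] tensorGr C D (p + q) :=
  LinearMap.mk₂ R (fun x y => ⟨(x : C.carrier) ⊗ₜ[R] (y : D.carrier),
      tmul_mem C D rfl x.2 y.2⟩)
    (fun _ _ _ => Subtype.ext (TensorProduct.add_tmul _ _ _))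
    (fun _ _ _ => Subtype.ext rfl)
    (fun _ _ _ => Subtype.ext (TensorProduct.tmul_add _ _ _))
    (fun _ _ _ => Subtype.ext (TensorProduct.tmul_smul _ _ _))

/-- Splitting of an element of `C ⊗ D` into its homogeneous components. -/
def tensorSplit (C D : DGModule R) : C.carrier ⊗[R] D.carrier →ₗ[R] ⨁ k, tensorGr C D k :=
  TensorProduct.lift <|
    DirectSum.toModule R ℕ _ (fun p => LinearMap.flip <|
      DirectSum.toModule R ℕ _ (fun q => LinearMap.flip <|
        (tensorOf C D p q).compr₂ (DirectSum.lof R ℕ (fun k => tensorGr C D k) (p + q))) ∘ₗ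
      (DirectSum.decomposeLinearEquiv D.gr).toLinearMap) ∘ₗ
    (DirectSum.decomposeLinearEquiv C.gr).toLinearMap

theorem tensorSplit_tmul (C D : DGModule R) {p q : ℕ} {x : C.carrier} {y : D.carrier}
    (hx : x ∈ C.gr p) (hy : y ∈ D.gr q) :
    tensorSplit C D (x ⊗ₜ y) =
      DirectSum.lof R ℕ (fun k => tensorGr C D k) (p + q) ⟨x ⊗ₜ y, tmul_mem C D rfl hx hy⟩ := by
  lift x to C.gr p using hx
  lift y to D.gr q using hy
  simp [tensorSplit, tensorOf]

/-- Two linear maps out of `C ⊗ D` agree if they agree on tensors of homogeneous elements. -/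
theorem tensor_ext {C D : DGModule R} {M : Type} [AddCommGroup M] [Module R M]
    {f g : C.carrier ⊗[R] D.carrier →ₗ[R] M}
    (h : ∀ p q, ∀ x ∈ C.gr p, ∀ y ∈ D.gr q, f (x ⊗ₜ y) = g (x ⊗ₜ y)) : f = g := by
  apply TensorProduct.ext'
  intro x y
  induction x using DirectSum.Decomposition.inductionOn C.gr with
  | zero => simp
  | add a b ha hb => simp [TensorProduct.add_tmul, ha, hb]
  | homogeneous x =>
    induction y using DirectSum.Decomposition.inductionOn D.gr with
    | zero => simp
    | add a b ha hb => simp [TensorProduct.tmul_add, ha, hb]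
    | homogeneous y => exact h _ _ _ x.2 _ y.2

instance tensorDecomposition (C D : DGModule R) : DirectSum.Decomposition (tensorGr C D) :=
  DirectSum.Decomposition.ofLinearMap (tensorGr C D) (tensorSplit C D)
    (by
      apply tensor_ext
      intro p q x hx y hy
      rw [LinearMap.comp_apply, tensorSplit_tmul C D hx hy]
      simp)
    (by
      apply DirectSum.linearMap_ext
      intro k
      ext ⟨z, hz⟩ : 1
      simp only [LinearMap.comp_apply, DirectSum.coeLinearMap_lof, LinearMap.id_apply]
      induction hz using Submodule.span_induction with
      | mem z hz =>
        obtain ⟨p, q, rfl, x, hx, y, hy, rfl⟩ := hz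
        exact tensorSplit_tmul C D hx hy
      | zero => exact (map_zero _).trans (map_zero _).symm
      | add a b ha hb iha ihb =>
        rw [map_add, iha, ihb, ← map_add]; rfl
      | smul r a ha iha =>
        rw [map_smul, iha, ← map_smul]; rfl)

/-- The differential `∂ ⊗ 1 + 1 ⊗ ∂` of the tensor product, with the Koszul sign:
`x ⊗ y ↦ ∂x ⊗ y + (-1) ^ dim x • x ⊗ ∂y`. -/
def tensorD (C D : DGModule R) : C.carrier ⊗[R] D.carrier →ₗ[R] C.carrier ⊗[R] D.carrier :=
  TensorProduct.map C.d LinearMap.id + TensorProduct.map C.sgn D.d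

theorem tensorD_tmul (C D : DGModule R) {p : ℕ} {x : C.carrier} (hx : x ∈ C.gr p)
    (y : D.carrier) :
    tensorD C D (x ⊗ₜ y) = C.d x ⊗ₜ y + (-1 : R) ^ p • (x ⊗ₜ[R] D.d y) := by
  simp only [tensorD, LinearMap.add_apply, TensorProduct.map_tmul, LinearMap.id_apply,
    C.sgn_of_mem hx, TensorProduct.smul_tmul']

/-- The tensor product of two differential graded modules. -/
abbrev tensor (C D : DGModule R) : DGModule R where
  carrier := C.carrier ⊗[R] D.carrier
  gr := tensorGr C D
  d := tensorD C D
  d_mem := by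
    intro k z hz
    induction hz using Submodule.span_induction with
    | mem z hz =>
      obtain ⟨p, q, h, x, hx, y, hy, rfl⟩ := hz
      rw [tensorD_tmul C D hx]
      refine add_mem ?_ (Submodule.smul_mem _ _ ?_)
      · cases p with
        | zero => simp [C.d_zero x hx]
        | succ p => exact tmul_mem C D (by omega) (C.d_mem p x hx) hy
      · cases q with
        | zero => simp [D.d_zero y hy]
        | succ q => exact tmul_mem C D (by omega) hx (D.d_mem q y hy)
    | zero => simp
    | add a b _ _ iha ihb => rw [map_add]; exact add_mem iha ihb
    | smul r a _ iha => rw [map_smul]; exact Submodule.smul_mem _ _ iha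
  d_zero := by
    intro z hz
    induction hz using Submodule.span_induction with
    | mem z hz =>
      obtain ⟨p, q, h, x, hx, y, hy, rfl⟩ := hz
      obtain ⟨rfl, rfl⟩ : p = 0 ∧ q = 0 := by omega
      rw [tensorD_tmul C D hx, C.d_zero x hx, D.d_zero y hy]
      simp
    | zero => simp
    | add a b _ _ iha ihb => rw [map_add, iha, ihb, add_zero]
    | smul r a _ iha => rw [map_smul, iha, smul_zero]
  d_d := by
    have : tensorD C D ∘ₗ tensorD C D = 0 := by
      apply tensor_ext
      intro p q x hx y hy
      rw [LinearMap.comp_apply, tensorD_tmul C D hx, map_add, map_smul, tensorD_tmul C D hx]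
      cases p with
      | zero => simp [C.d_zero x hx, D.d_d]
      | succ p =>
        rw [tensorD_tmul C D (C.d_mem p x hx), C.d_d, D.d_d]
        simp [pow_succ]
    exact fun x => LinearMap.congr_fun this x

/-- Chain maps: linear maps of degree `0` that commute with the differentials. -/
structure IsChainMap (C D : DGModule R) (f : C.carrier →ₗ[R] D.carrier) : Prop where
  map_gr : ∀ k, ∀ x ∈ C.gr k, f x ∈ D.gr k
  map_d : ∀ x, f (C.d x) = D.d (f x)

/-- The interchange `(A ⊗ B) ⊗ (C ⊗ D) → (A ⊗ C) ⊗ (B ⊗ D)`,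
`(a ⊗ b) ⊗ (c ⊗ d) ↦ (-1) ^ (dim b * dim c) • (a ⊗ c) ⊗ (b ⊗ d)`. -/
def interchange (A B C D : DGModule R) :
    (A.carrier ⊗[R] B.carrier) ⊗[R] (C.carrier ⊗[R] D.carrier) →ₗ[R]
      (A.carrier ⊗[R] C.carrier) ⊗[R] (B.carrier ⊗[R] D.carrier) :=
  (TensorProduct.assoc R A.carrier C.carrier (B.carrier ⊗[R] D.carrier)).symm.toLinearMap ∘ₗ
  LinearMap.lTensor A.carrier
    ((TensorProduct.assoc R C.carrier B.carrier D.carrier).toLinearMap ∘ₗ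
      LinearMap.rTensor D.carrier (swap B C) ∘ₗ
      (TensorProduct.assoc R B.carrier C.carrier D.carrier).symm.toLinearMap) ∘ₗ
  (TensorProduct.assoc R A.carrier B.carrier (C.carrier ⊗[R] D.carrier)).toLinearMap

theorem interchange_tmul (A B C D : DGModule R) {p q : ℕ} (a : A.carrier) {b : B.carrier}
    {c : C.carrier} (d : D.carrier) (hb : b ∈ B.gr p) (hc : c ∈ C.gr q) :
    interchange A B C D ((a ⊗ₜ[R] b) ⊗ₜ[R] (c ⊗ₜ[R] d)) =
      (-1 : R) ^ (p * q) • ((a ⊗ₜ[R] c) ⊗ₜ[R] (b ⊗ₜ[R] d)) := by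
  simp only [interchange, LinearMap.comp_apply, LinearEquiv.coe_coe, TensorProduct.assoc_tmul,
    LinearMap.lTensor_tmul, TensorProduct.assoc_symm_tmul, LinearMap.rTensor_tmul,
    swap_tmul B C hb hc]
  rw [← TensorProduct.smul_tmul', map_smul, TensorProduct.tmul_smul, map_smul]
  rfl

end DGModule

end DG

/-! ## Block permutations -/

/-- Replacing the `i`-th of `m` positions by a block of `n` consecutive positions gives
`N = n + m - 1` positions: `inl x` is the `x`-th position in the block, and `inr j` is the
position that comes from `j ≠ i`. -/
def blockPos {n m N : ℕ} (h : N + 1 = n + m) (i : Fin m) :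
    Fin n ⊕ {j : Fin m // j ≠ i} → Fin N
  | Sum.inl x => ⟨i + x, by omega⟩
  | Sum.inr j =>
      if hj : (j : Fin m) < i then ⟨j, by have := i.2; have : (j : Fin m).1 < i.1 := hj; omega⟩
      else ⟨n + (j : Fin m) - 1, by
        have h1 := (j : Fin m).2
        have h2 : i.1 < (j : Fin m).1 := by
          have := Fin.val_ne_of_ne j.2
          have : ¬ (j : Fin m).1 < i.1 := hj
          omega
        omega⟩

theorem blockPos_bijective {n m N : ℕ} (h : N + 1 = n + m) (i : Fin m) :
    Function.Bijective (blockPos h i) := by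
  rw [Fintype.bijective_iff_injective_and_card]
  constructor
  · rintro (x | ⟨j, hj⟩) (y | ⟨k, hk⟩) hxy
    · simp only [blockPos, Fin.mk.injEq] at hxy
      congr 1; ext; omega
    · have hk' := Fin.val_ne_of_ne hk
      simp only [blockPos] at hxy
      split_ifs at hxy with h1 <;> simp only [Fin.mk.injEq, Fin.lt_def] at hxy h1 <;> omega
    · have hj' := Fin.val_ne_of_ne hj
      simp only [blockPos] at hxy
      split_ifs at hxy with h1 <;> simp only [Fin.mk.injEq, Fin.lt_def] at hxy h1 <;> omega
    · have hj' := Fin.val_ne_of_ne hj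
      have hk' := Fin.val_ne_of_ne hk
      have : j = k := by
        simp only [blockPos] at hxy
        split_ifs at hxy with h1 h2 h2 <;>
          simp only [Fin.mk.injEq, Fin.lt_def] at hxy h1 h2 <;> ext <;> omega
      subst this; rfl
  · have := i.2
    simp
    omega

/-- `blockPos` as a bijection. -/
def blockEquiv {n m N : ℕ} (h : N + 1 = n + m) (i : Fin m) :
    Fin n ⊕ {j : Fin m // j ≠ i} ≃ Fin N :=
  Equiv.ofBijective _ (blockPos_bijective h i)

/-- The permutation of `n + m - 1` positions by which `σ ∈ S_m` permutes `m` consecutive blocks,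
the `i`-th of which has length `n` and the others length `1`: the block number `j` is moved, in
order, to the block number `σ j`. -/
def blockPerm {n m N : ℕ} (h : N + 1 = n + m) (i : Fin m) (σ : Equiv.Perm (Fin m)) :
    Equiv.Perm (Fin N) :=
  (blockEquiv h i).symm.trans <|
    (Equiv.sumCongr (Equiv.refl (Fin n))
      (σ.subtypeEquiv (p := fun j => j ≠ i) (q := fun j => j ≠ σ i) (by simp))).trans <|
    blockEquiv h (σ i)

/-- The block sum `1 ⊕ ⋯ ⊕ τ ⊕ ⋯ ⊕ 1` with `τ ∈ S_n` acting on the `i`-th of `m` blocks. -/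
def blockSum {n m N : ℕ} (h : N + 1 = n + m) (i : Fin m) (τ : Equiv.Perm (Fin n)) :
    Equiv.Perm (Fin N) :=
  (blockEquiv h i).symm.trans <|
    (Equiv.sumCongr τ (Equiv.refl {j : Fin m // j ≠ i})).trans <| blockEquiv h i

/-! ## Operads -/

section Operads

variable {R : Type} [CommRing R]

/-- A family of composition operations `∘ᵢ : U n ⊗ U m → U (n + m - 1)`, where the number
`N = n + m - 1` is passed as an argument. Positions `i` are counted from `0`. -/
abbrev Compositions (U : ℕ+ → DGModule R) : Type :=
  ∀ n m N : ℕ+, (N : ℕ) + 1 = n + m → Fin m →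
    ((U n).carrier ⊗[R] (U m).carrier →ₗ[R] (U N).carrier)

namespace Compositions

variable {U : ℕ+ → DGModule R} (c : Compositions U)

/-- The composition `a ∘ᵢ b` of two elements. -/
def circ {n m N : ℕ+} (h : (N : ℕ) + 1 = n + m) (i : Fin m) (a : (U n).carrier)
    (b : (U m).carrier) : (U N).carrier :=
  c n m N h i (a ⊗ₜ[R] b)

/-- All compositions are chain maps. -/
def AreChainMaps : Prop :=
  ∀ n m N h i, DGModule.IsChainMap ((U n).tensor (U m)) (U N) (c n m N h i)

/-- Equivariance of the compositions with respect to given left actions of the symmetric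
groups. -/
structure IsEquivariant (act : ∀ n : ℕ+, Representation R (Equiv.Perm (Fin n)) (U n).carrier) :
    Prop where
  /-- `a ∘_{σ(i)} (σ b) = T(σ) (a ∘ᵢ b)` with the block permutation `T(σ)` -/
  circ_act : ∀ {n m N : ℕ+} (h : (N : ℕ) + 1 = n + m) (i : Fin m) (σ : Equiv.Perm (Fin m))
    (a : (U n).carrier) (b : (U m).carrier),
    c.circ h (σ i) a (act m σ b) = act N (blockPerm h i σ) (c.circ h i a b)
  /-- `(τ a) ∘ᵢ b = (1 ⊕ ⋯ ⊕ τ ⊕ ⋯ ⊕ 1) (a ∘ᵢ b)` -/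
  act_circ : ∀ {n m N : ℕ+} (h : (N : ℕ) + 1 = n + m) (i : Fin m) (τ : Equiv.Perm (Fin n))
    (a : (U n).carrier) (b : (U m).carrier),
    c.circ h i (act n τ a) b = act N (blockSum h i τ) (c.circ h i a b)

end Compositions

/-- The data of an operad with components of rank `n > 0`: the components, the left actions of the
symmetric groups, the unit and the compositions. -/
structure OperadData (R : Type) [CommRing R] where
  U : ℕ+ → DGModule R
  act : ∀ n : ℕ+, Representation R (Equiv.Perm (Fin n)) (U n).carrier
  unit : (U 1).carrier
  comp : Compositions U

namespace OperadData

/-- The laws of an operad. An element `a` of rank `n` behaves like a map `C → Cⁿ`, and `a ∘ᵢ b` is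
`b` followed by `a` on the `i`-th factor. -/
structure IsOperad (O : OperadData R) : Prop where
  free : ∀ n, Module.Free R (O.U n).carrier
  act_chainMap : ∀ n σ, DGModule.IsChainMap (O.U n) (O.U n) (O.act n σ)
  unit_mem : O.unit ∈ (O.U 1).gr 0
  comp_chainMap : O.comp.AreChainMaps
  /-- `(a ∘ᵢ b) ∘ⱼ c = a ∘ᵢ₊ⱼ (b ∘ⱼ c)` (positions counted from `0`) -/
  assoc : ∀ {n m t nm mt N : ℕ+} (h₁ : (nm : ℕ) + 1 = n + m) (h₂ : (N : ℕ) + 1 = nm + t)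
    (h₃ : (mt : ℕ) + 1 = m + t) (h₄ : (N : ℕ) + 1 = n + mt)
    (i : Fin m) (j : Fin t) (l : Fin mt), (l : ℕ) = i + j →
    ∀ (a : (O.U n).carrier) (b : (O.U m).carrier) (c : (O.U t).carrier),
    O.comp.circ h₂ j (O.comp.circ h₁ i a b) c = O.comp.circ h₄ l a (O.comp.circ h₃ j b c)
  /-- `a ∘ᵢ₊ₘ₋₁ (b ∘ⱼ c) = (-1) ^ (dim a * dim b) • b ∘ⱼ (a ∘ᵢ c)` for `j < i` -/
  comm : ∀ {n m t nt mt N : ℕ+} (h₁ : (mt : ℕ) + 1 = m + t) (h₂ : (N : ℕ) + 1 = n + mt)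
    (h₃ : (nt : ℕ) + 1 = n + t) (h₄ : (N : ℕ) + 1 = m + nt)
    (i j : Fin t), j < i → ∀ (l : Fin mt), (l : ℕ) + 1 = i + m →
    ∀ (j' : Fin nt), (j' : ℕ) = j →
    ∀ (p q : ℕ), ∀ a ∈ (O.U n).gr p, ∀ b ∈ (O.U m).gr q, ∀ c : (O.U t).carrier,
    O.comp.circ h₂ l a (O.comp.circ h₁ j b c) =
      (-1 : R) ^ (p * q) • O.comp.circ h₄ j' b (O.comp.circ h₃ i a c)
  equivariant : O.comp.IsEquivariant O.act
  unit_circ : ∀ {n : ℕ+} (h : (n : ℕ) + 1 = (1 : ℕ+) + n) (i : Fin n) (b : (O.U n).carrier),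
    O.comp.circ h i O.unit b = b
  circ_unit : ∀ {n : ℕ+} (h : (n : ℕ) + 1 = n + (1 : ℕ+)) (i : Fin (1 : ℕ+))
    (a : (O.U n).carrier), O.comp.circ h i a O.unit = a

/-- The tensor product of operads: components `U n ⊗ V n` with the diagonal actions, and
`(a ⊗ b) ∘ᵢ (c ⊗ d) = (-1) ^ (dim b * dim c) • (a ∘ᵢ c) ⊗ (b ∘ᵢ d)`. -/
abbrev tensor (O P : OperadData R) : OperadData R where
  U n := (O.U n).tensor (P.U n)
  act n := (O.act n).tprod (P.act n)
  unit := O.unit ⊗ₜ[R] P.unit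
  comp n m N h i :=
    TensorProduct.map (O.comp n m N h i) (P.comp n m N h i) ∘ₗ
      DGModule.interchange (O.U n) (P.U n) (O.U m) (P.U m)

theorem tensor_circ (O P : OperadData R) {n m N : ℕ+} (h : (N : ℕ) + 1 = n + m) (i : Fin m)
    {p q : ℕ} (a : (O.U n).carrier) {b : (P.U n).carrier} {c : (O.U m).carrier}
    (d : (P.U m).carrier) (hb : b ∈ (P.U n).gr p) (hc : c ∈ (O.U m).gr q) :
    (O.tensor P).comp.circ h i (a ⊗ₜ[R] b) (c ⊗ₜ[R] d) =
      (-1 : R) ^ (p * q) • (O.comp.circ h i a c ⊗ₜ[R] P.comp.circ h i b d) := by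
  change TensorProduct.map _ _ (DGModule.interchange _ _ _ _ _) = _
  rw [DGModule.interchange_tmul _ _ _ _ a d hb hc, map_smul]
  rfl

/-- Morphisms of operads: chain maps of the components that respect the symmetric group actions,
the unit and the compositions. -/
structure IsMorphism (O P : OperadData R)
    (f : ∀ n, (O.U n).carrier →ₗ[R] (P.U n).carrier) : Prop where
  chainMap : ∀ n, DGModule.IsChainMap (O.U n) (P.U n) (f n)
  map_act : ∀ n σ x, f n (O.act n σ x) = P.act n σ (f n x)
  map_unit : f 1 O.unit = P.unit
  map_circ : ∀ {n m N : ℕ+} (h : (N : ℕ) + 1 = n + m) (i : Fin m)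
    (a : (O.U n).carrier) (b : (O.U m).carrier),
    f N (O.comp.circ h i a b) = P.comp.circ h i (f n a) (f m b)

/-- Coassociativity of a family of maps `Δ n : U n → U n ⊗ U n`. -/
def IsCoassociative (O : OperadData R)
    (Δ : ∀ n, (O.U n).carrier →ₗ[R] (O.U n).carrier ⊗[R] (O.U n).carrier) : Prop :=
  ∀ n x, TensorProduct.assoc R _ _ _ (TensorProduct.map (Δ n) LinearMap.id (Δ n x)) =
    TensorProduct.map LinearMap.id (Δ n) (Δ n x)

/-- The family `Δ` makes the operad `O` an operad-coalgebra: it is a coassociative morphism of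
operads `O → O ⊗ O`. -/
def IsOperadCoproduct (O : OperadData R)
    (Δ : ∀ n, (O.U n).carrier →ₗ[R] (O.U n).carrier ⊗[R] (O.U n).carrier) : Prop :=
  IsMorphism O (O.tensor O) Δ ∧ O.IsCoassociative Δ

end OperadData

/-- A differential graded module with an action of `G` is an `R[G]`-free resolution of `R`: there
is an augmentation `ε` onto the trivial module `R` such that `⋯ → C₁ → C₀ → R → 0` is an exact sequence
of `R[G]`-modules, and every `Cₖ` is a free `R[G]`-module. -/
structure DGModule.IsFreeResolution (C : DGModule R) {G : Type} [Group G]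
    (ρ : Representation R G C.carrier) : Prop where
  act_chainMap : ∀ g, IsChainMap C C (ρ g)
  free : ∀ k, ∃ P : Submodule (MonoidAlgebra R G) ρ.asModule,
    (∀ x, x ∈ P ↔ ρ.asModuleEquiv x ∈ C.gr k) ∧ Module.Free (MonoidAlgebra R G) P
  exact : ∀ k, ∀ x ∈ C.gr (k + 1), C.d x = 0 → ∃ y ∈ C.gr (k + 2), C.d y = x
  augmentation : ∃ ε : C.carrier →ₗ[R] R,
    (∀ k, ∀ x ∈ C.gr (k + 1), ε x = 0) ∧ (∀ g x, ε (ρ g x) = ε x) ∧ Function.Surjective ε ∧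
    ∀ x ∈ C.gr 0, ε x = 0 ↔ ∃ y ∈ C.gr 1, C.d y = x

/-- An `E_∞`-operad: an operad whose `n`-th component is an `R[S_n]`-free resolution of `R` for all
`n > 0`. -/
def OperadData.IsEInfinity (O : OperadData R) : Prop :=
  O.IsOperad ∧ ∀ n, (O.U n).IsFreeResolution (O.act n)

end Operads

/-! ## The bar resolution -/

/-- The underlying module of the (normalized) bar resolution of `R` over `R[G]`, with basis the
elements `g[a₁|…|aₖ]`, `g, aᵢ ∈ G`, `aᵢ ≠ 1`. -/
abbrev BarModule (R G : Type) [CommRing R] [Group G] : Type := (G × {l : List G // 1 ∉ l}) →₀ R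

section Bar

variable {R G : Type} [CommRing R] [Group G]

open Classical in
/-- The element `g[a₁|…|aₖ]`, which is zero if some `aᵢ` is `1`. -/
def bar (g : G) (l : List G) : BarModule R G :=
  if h : 1 ∉ l then Finsupp.single (g, ⟨l, h⟩) 1 else 0

/-- The contraction of two neighbouring entries of a list:
`a₁, …, aₖ ↦ a₁, …, aᵢ₊₁ * aᵢ₊₂, …, aₖ`. -/
def mulAt : ℕ → List G → List G
  | 0, a :: b :: l => (a * b) :: l
  | i + 1, a :: l => a :: mulAt i l
  | _, l => l

/-- The face operators
`F₀ (g[a₁|…|aₖ]) = g a₁[a₂|…|aₖ]`, `Fᵢ (g[a₁|…|aₖ]) = g[a₁|…|aᵢ aᵢ₊₁|…|aₖ]` for `0 < i < k`, and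
`Fₖ (g[a₁|…|aₖ]) = g[a₁|…|aₖ₋₁]`. -/
def barFace (i : ℕ) (g : G) (l : List G) : BarModule R G :=
  if i = 0 then bar (g * l.headD 1) l.tail
  else if i < l.length then bar g (mulAt (i - 1) l)
  else bar g l.dropLast

/-- The differential on basis elements: the alternating sum of the faces, and zero in
dimension `0`. -/
def barDiff (g : G) (l : List G) : BarModule R G :=
  if l = [] then 0 else ∑ i ∈ Finset.range (l.length + 1), (-1 : R) ^ i • barFace i g l

/-- The differential of the bar resolution. -/
def barD : BarModule R G →ₗ[R] BarModule R G :=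
  Finsupp.linearCombination R fun x => barDiff x.1 x.2.1

/-- The left action `h • g[a₁|…|aₖ] = (h g)[a₁|…|aₖ]`. -/
def barAct : Representation R G (BarModule R G) where
  toFun h := Finsupp.lmapDomain R R fun x => (h * x.1, x.2)
  map_one' := by ext; simp
  map_mul' a b := by ext x : 2; simp [mul_assoc]

/-- Elements of dimension `k`: combinations of the `g[a₁|…|aₖ]`. -/
def barGr (k : ℕ) : Submodule R (BarModule R G) :=
  Finsupp.supported R R {x | x.2.1.length = k}

/-- The submodule `A(G, 1)` spanned by the elements `1[a₁|…|aₖ]`, `k ≥ 0`. -/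
def barA : Submodule R (BarModule R G) :=
  Submodule.span R (Set.range fun l : List G => bar 1 l)

/-- The augmentation: `g[] ↦ 1`, and `g[a₁|…|aₖ] ↦ 0` for `k > 0`. -/
def barAug : BarModule R G →ₗ[R] R :=
  Finsupp.linearCombination R fun x => if x.2.1.length = 0 then 1 else 0

/-- The coproduct
`g[a₁|…|aₖ] ↦ ∑ᵢ g[a₁|…|aᵢ] ⊗ g a₁⋯aᵢ[aᵢ₊₁|…|aₖ]`. -/
def barCoprod : BarModule R G →ₗ[R] BarModule R G ⊗[R] BarModule R G :=
  Finsupp.linearCombination R fun x =>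
    ∑ i ∈ Finset.range (x.2.1.length + 1),
      bar x.1 (x.2.1.take i) ⊗ₜ[R] bar (x.1 * (x.2.1.take i).prod) (x.2.1.drop i)

/-- The contraction `g[a₁|…|aₖ] ↦ 1[g|a₁|…|aₖ]`. -/
def barPhi : BarModule R G →ₗ[R] BarModule R G :=
  Finsupp.linearCombination R fun x => bar 1 (x.1 :: x.2.1)

theorem barPhi_bar (g : G) (l : List G) :
    barPhi (bar g l : BarModule R G) = bar 1 (g :: l) := by
  by_cases h : (1 : G) ∈ l
  · simp [bar, h]
  · simp [bar, h, barPhi]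

theorem barAct_bar (a g : G) (l : List G) :
    barAct a (bar g l : BarModule R G) = bar (a * g) l := by
  by_cases h : (1 : G) ∈ l
  · simp [bar, h]
  · simp [bar, h, barAct]

theorem barD_bar (g : G) (l : List G) (h : 1 ∉ l) :
    barD (bar g l : BarModule R G) = barDiff g l := by
  simp [bar, h, barD]

theorem barAug_bar (g : G) (l : List G) (h : 1 ∉ l) :
    barAug (bar g l : BarModule R G) = if l.length = 0 then 1 else 0 := by
  simp [bar, h, barAug]

theorem bar_ext {M : Type} [AddCommGroup M] [Module R M] {f g : BarModule R G →ₗ[R] M}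
    (h : ∀ a l, 1 ∉ l → f (bar a l) = g (bar a l)) : f = g := by
  ext ⟨a, l, hl⟩ : 2
  have := h a l hl
  simpa [bar, hl] using this

theorem barPhi_barPhi (x : BarModule R G) : barPhi (barPhi x) = 0 := by
  have : (barPhi ∘ₗ barPhi : BarModule R G →ₗ[R] BarModule R G) = 0 :=
    bar_ext fun g l hl => by
      rw [LinearMap.comp_apply, barPhi_bar, barPhi_bar]
      simp [bar]
  exact LinearMap.congr_fun this x

theorem barAug_barPhi (x : BarModule R G) : barAug (barPhi x) = 0 := by
  have : (barAug ∘ₗ barPhi : BarModule R G →ₗ[R] R) = 0 :=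
    bar_ext fun g l hl => by
      rw [LinearMap.comp_apply, barPhi_bar]
      by_cases h : (1 : G) ∈ g :: l
      · simp [bar, h]
      · simp [barAug_bar _ _ h]
  exact LinearMap.congr_fun this x

theorem barAug_act (a : G) (x : BarModule R G) : barAug (barAct a x) = barAug x := by
  have : (barAug ∘ₗ barAct a : BarModule R G →ₗ[R] R) = barAug :=
    bar_ext fun g l hl => by simp [barAct_bar, barAug_bar _ _ hl]
  exact LinearMap.congr_fun this x

theorem bar_mem_barGr (g : G) (l : List G) {k : ℕ} (h : 1 ∉ l → l.length = k) :
    (bar g l : BarModule R G) ∈ barGr k := by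
  by_cases hl : (1 : G) ∈ l
  · simp [bar, hl]
  · simp only [bar, hl, not_false_eq_true, dite_true]
    exact Finsupp.single_mem_supported _ _ (h hl)

theorem mulAt_length (i : ℕ) (l : List G) (h : i + 1 < l.length) :
    (mulAt i l).length + 1 = l.length := by
  induction i generalizing l with
  | zero =>
    match l, h with
    | a :: b :: l, _ => simp [mulAt]
  | succ i ih =>
    match l, h with
    | a :: l, h =>
      have := ih l (by simpa using h)
      simp [mulAt, this]

theorem barFace_mem (i : ℕ) (g : G) (l : List G) {k : ℕ} (h : l.length = k + 1) :
    (barFace i g l : BarModule R G) ∈ barGr k := by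
  unfold barFace
  split_ifs with h1 h2
  · exact bar_mem_barGr _ _ fun _ => by simp [h]
  · exact bar_mem_barGr _ _ fun _ => by
      have := mulAt_length (i - 1) l (by omega)
      omega
  · exact bar_mem_barGr _ _ fun _ => by simp [h]

theorem barD_mem (k : ℕ) (x : BarModule R G) (hx : x ∈ barGr (k + 1)) : barD x ∈ barGr k := by
  unfold barD
  rw [Finsupp.linearCombination_apply]
  refine Submodule.sum_mem _ fun y hy => Submodule.smul_mem _ _ ?_
  have hy' : y.2.1.length = k + 1 := hx hy
  unfold barDiff
  split_ifs with h
  · simp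
  · exact Submodule.sum_mem _ fun i _ => Submodule.smul_mem _ _ (barFace_mem i _ _ hy')

theorem barD_zero (x : BarModule R G) (hx : x ∈ barGr 0) : barD x = 0 := by
  unfold barD
  rw [Finsupp.linearCombination_apply]
  refine Finset.sum_eq_zero fun y hy => ?_
  have hy' : y.2.1.length = 0 := hx hy
  simp [barDiff, List.length_eq_zero_iff.1 hy']

theorem barDiff_nil (g : G) : (barDiff g [] : BarModule R G) = 0 := by simp [barDiff]

theorem barAct_barFace (i : ℕ) (a g : G) (l : List G) :
    barAct a (barFace i g l : BarModule R G) = barFace i (a * g) l := by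
  unfold barFace
  split_ifs <;> simp [barAct_bar, mul_assoc]

theorem barAct_barDiff (a g : G) (l : List G) :
    barAct a (barDiff g l : BarModule R G) = barDiff (a * g) l := by
  unfold barDiff
  split_ifs
  · simp
  · simp [barAct_barFace]

/-- The differential commutes with the action of `G`. -/
theorem barD_act (a : G) (x : BarModule R G) : barD (barAct a x) = barAct a (barD x) := by
  have : barD ∘ₗ barAct a = barAct a ∘ₗ (barD : BarModule R G →ₗ[R] BarModule R G) :=
    bar_ext fun g l hl => by
      simp [barAct_bar, barD_bar _ _ hl, barAct_barDiff]
  exact LinearMap.congr_fun this x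

theorem barFace_succ_cons (i : ℕ) (a : G) (l : List G) (hl : l ≠ []) (hi : i ≤ l.length) :
    (barFace (i + 1) 1 (a :: l) : BarModule R G) = barPhi (barFace i a l) := by
  obtain ⟨b, t, rfl⟩ := List.exists_cons_of_ne_nil hl
  unfold barFace
  rcases i with _ | i
  · simp [mulAt, barPhi_bar]
  · by_cases h : i + 1 < (b :: t).length
    · have h' : i + 1 + 1 < (a :: b :: t).length := by simpa using h
      rw [if_neg (by omega), if_pos h', if_neg (by omega), if_pos h, barPhi_bar]
      rfl
    · have h' : ¬ i + 1 + 1 < (a :: b :: t).length := by simpa using h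
      rw [if_neg (by omega), if_neg h', if_neg (by omega), if_neg h, barPhi_bar]
      rfl

theorem barDiff_cons (a : G) (l : List G) :
    (barDiff 1 (a :: l) : BarModule R G) =
      bar a l - barPhi (barDiff a l) - (if l.length = 0 then 1 else 0 : R) • bar 1 [] := by
  rcases eq_or_ne l [] with rfl | hl
  · simp [barDiff, barFace, Finset.sum_range_succ, sub_eq_add_neg]
  · have hl' : l.length ≠ 0 := by simpa using hl
    rw [barDiff, if_neg (by simp), List.length_cons, Finset.sum_range_succ', if_neg hl', barDiff,
      if_neg hl, map_sum]
    rw [Finset.sum_congr rfl fun i hi => by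
      rw [barFace_succ_cons i a l hl (by simp at hi; omega)]]
    have h0 : (barFace 0 1 (a :: l) : BarModule R G) = bar a l := by simp [barFace]
    simp only [h0, map_smul, pow_succ, mul_neg, mul_one, neg_smul, Finset.sum_neg_distrib, pow_zero,
      one_smul, zero_smul, sub_zero]
    abel

/-- The map `barPhi` is a contracting homotopy. -/
theorem barD_barPhi (x : BarModule R G) :
    barD (barPhi x) = x - barPhi (barD x) - barAug x • bar 1 [] := by
  have : (barD ∘ₗ barPhi : BarModule R G →ₗ[R] BarModule R G) =
      LinearMap.id - barPhi ∘ₗ barD - LinearMap.toSpanSingleton R _ (bar 1 []) ∘ₗ barAug := by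
    refine bar_ext fun g l hl => ?_
    simp only [LinearMap.comp_apply, LinearMap.sub_apply, LinearMap.id_apply, barPhi_bar,
      LinearMap.toSpanSingleton_apply, barAug_bar g l hl, barD_bar g l hl]
    by_cases hg : g = 1
    · subst hg
      have h0 : (bar 1 (1 :: l) : BarModule R G) = 0 := by simp [bar]
      rw [h0, map_zero]
      rcases l with _ | ⟨b, t⟩
      · simp [barDiff_nil]
      · rw [barDiff_cons, map_sub, map_sub, barPhi_bar, map_smul, barPhi_bar, barPhi_barPhi]
        have h1 : (bar 1 [1] : BarModule R G) = 0 := by simp [bar]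
        simp [h1]
    · have hgl : 1 ∉ g :: l := by simpa [eq_comm, hg] using hl
      rw [barD_bar _ _ hgl, barDiff_cons]
  exact LinearMap.congr_fun this x

theorem barAug_barD (x : BarModule R G) : barAug (barD x) = 0 := by
  have : (barAug ∘ₗ barD : BarModule R G →ₗ[R] R) = 0 := by
    refine bar_ext fun g l hl => ?_
    rw [LinearMap.comp_apply, barD_bar g l hl]
    rcases l with _ | ⟨a, l⟩
    · simp [barDiff_nil]
    · have ha : 1 ∉ l := fun h => hl (List.mem_cons_of_mem _ h)
      rw [show (barDiff g (a :: l) : BarModule R G) = barAct g (barDiff 1 (a :: l)) by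
        simp [barAct_barDiff], barAug_act, barDiff_cons, map_sub, map_sub, barAug_bar _ _ ha,
        barAug_barPhi, map_smul, barAug_bar _ _ (by simp)]
      simp
  exact LinearMap.congr_fun this x

theorem barD_barD (x : BarModule R G) : barD (barD x) = 0 := by
  have key : ∀ (l : List G) (g : G), 1 ∉ l → barD (barD (bar g l : BarModule R G)) = 0 := by
    intro l
    induction l with
    | nil => intro g _; simp [barD_bar, barDiff_nil]
    | cons a l ih =>
      intro g hl
      have ha : 1 ∉ l := fun h => hl (List.mem_cons_of_mem _ h)
      have h1 : (bar g (a :: l) : BarModule R G) = barAct g (barPhi (bar a l)) := by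
        rw [barPhi_bar, barAct_bar, mul_one]
      have h2 : barD (bar 1 [] : BarModule R G) = 0 := by simp [barD_bar, barDiff_nil]
      rw [h1, barD_act, barD_act, barD_barPhi, map_sub barD, map_sub barD, map_smul barD, h2,
        barD_barPhi, ih a ha, barAug_barD]
      simp
  have : (barD ∘ₗ barD : BarModule R G →ₗ[R] BarModule R G) = 0 :=
    bar_ext fun g l hl => key l g hl
  exact LinearMap.congr_fun this x

/-- Splitting of an element of the bar resolution into its homogeneous components. -/
def barSplit : BarModule R G →ₗ[R] ⨁ k, barGr (R := R) (G := G) k :=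
  Finsupp.linearCombination R fun x =>
    DirectSum.lof R ℕ (fun k => barGr (R := R) (G := G) k) x.2.1.length
      ⟨Finsupp.single x 1, Finsupp.single_mem_supported _ _ rfl⟩

instance barDecomposition : DirectSum.Decomposition (barGr (R := R) (G := G)) :=
  DirectSum.Decomposition.ofLinearMap _ barSplit
    (by
      ext x : 2
      simp [barSplit])
    (by
      apply DirectSum.linearMap_ext
      intro k
      ext ⟨z, hz⟩ : 1
      simp only [LinearMap.comp_apply, DirectSum.coeLinearMap_lof, LinearMap.id_apply]
      have hz' := hz
      rw [barGr, Finsupp.supported_eq_span_single] at hz'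
      induction hz' using Submodule.span_induction with
      | mem z hz' =>
        obtain ⟨x, hx, rfl⟩ := hz'
        obtain rfl : x.2.1.length = k := hx
        simp [barSplit]
      | zero => exact (map_zero _).trans (map_zero _).symm
      | add a b ha hb iha ihb =>
        rw [← Finsupp.supported_eq_span_single] at ha hb
        rw [map_add, iha ha, ihb hb, ← map_add]; rfl
      | smul r a ha iha =>
        rw [← Finsupp.supported_eq_span_single] at ha
        rw [map_smul, iha ha, ← map_smul]; rfl)

end Bar

/-- The (normalized) bar resolution of `R` over `R[G]`. -/
abbrev barResolution (R G : Type) [CommRing R] [Group G] : DGModule R where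
  carrier := BarModule R G
  gr := barGr
  d := barD
  d_mem := barD_mem
  d_zero := barD_zero
  d_d := barD_barD

/-! ## The operad `𝔖` -/

/-- The bar resolution `RS_n` of `ℤ` over `ℤS_n`. -/
abbrev RS (n : ℕ+) : DGModule ℤ := barResolution ℤ (Equiv.Perm (Fin n))

/-- The conditions on the compositions of `𝔖`: they are chain maps that preserve the augmentations,
they are equivariant, and `A(S_n, 1) ∘ᵢ A(S_m, 1) ⊆ A(S_{n+m-1}, 1)`. -/
structure IsCartanComposition (c : Compositions RS) : Prop where
  chainMap : c.AreChainMaps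
  augmentation : ∀ {n m N : ℕ+} (h : (N : ℕ) + 1 = n + m) (i : Fin m) (a : (RS n).carrier)
    (b : (RS m).carrier), barAug (c.circ h i a b) = barAug a * barAug b
  equivariant : c.IsEquivariant fun _ => barAct
  circ_mem : ∀ {n m N : ℕ+} (h : (N : ℕ) + 1 = n + m) (i : Fin m),
    ∀ a ∈ barA (R := ℤ) (G := Equiv.Perm (Fin n)), ∀ b ∈ barA (R := ℤ) (G := Equiv.Perm (Fin m)),
    c.circ h i a b ∈ barA (R := ℤ) (G := Equiv.Perm (Fin N))

/-- The sequence `𝔖` of the bar resolutions `RS_n` with compositions `c`; the unit is `[] ∈ RS_1`. -/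
abbrev operadS (c : Compositions RS) : OperadData ℤ where
  U := RS
  act _ := barAct
  unit := bar 1 []
  comp := c

end

open scoped TensorProduct DirectSum

noncomputable section

/-! ## Chain maps -/

section ChainMaps

variable {R : Type} [CommRing R]

namespace DGModule

/-! The proof is the method of acyclic carriers with chosen contractions, so that chain maps agree
on the nose and not only up to homotopy. A contraction satisfies `dh + hd = 1 - ε·pt`, `hh = 0` and
`h pt = 0`; hence an element `x` with `h x = 0` equals `h (d x) + ε x • pt`. So if two chain maps
with the same augmentation send each generator into the kernel of a contraction chosen for that
generator, they coincide, by induction on the dimension (`Generates.chainMap_unique`). The same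
formula, read as a recursion, constructs such a map (`carried`).

The bar resolution of `G` has one contraction for each `g`, the cone `a[l] ↦ g[g⁻¹a|l]`. Its kernel
is spanned by the elements `g[…]`; for `g = 1` this is `A(G, 1)`. Equivariance therefore turns the
condition on the subgroups `A(S_n, 1)` into the statement that `g[…] ∘ᵢ k[…]` is killed by the cone
at the permutation `blockMul h i (g, k)`, and uniqueness of the compositions follows.

For existence, the recursion gives a cross product `RG ⊗ RH → R(G × H)` carried by the cones at `(g,
h)`. In homogeneous coordinates `RG` depends only on the set `G`, so every map of sets, in
particular `blockMul h i`, induces a chain map `barMap`. The composition is the cross product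
followed by this map. Each operad law then splits into a law of the cross product, which is again an
instance of `chainMap_unique`, and an identity between permutations, checked position by position.

The coproduct commutes with the cones when a tensor product is contracted by `h ⊗ 1 + pt ε ⊗ h`.
This gives its naturality and coassociativity (`eq_of_barCone_isHom`); its compatibility with the
cross product is `chainMap_unique` once more. The resolution property comes from the `R[G]`-basis
`1[…]` and the homotopy `barPhi`. -/

theorem d_mem_pred (C : DGModule R) {k : ℕ} {x : C.carrier} (hx : x ∈ C.gr k) :
    C.d x = 0 ∨ ∃ l, k = l + 1 ∧ C.d x ∈ C.gr l := by
  cases k with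
  | zero => exact Or.inl (C.d_zero x hx)
  | succ l => exact Or.inr ⟨l, rfl, C.d_mem l x hx⟩

namespace IsChainMap

variable {A B C D : DGModule R}

theorem id (C : DGModule R) : IsChainMap C C LinearMap.id :=
  ⟨fun _ _ hx => hx, fun _ => rfl⟩

theorem comp {g : B.carrier →ₗ[R] C.carrier} {f : A.carrier →ₗ[R] B.carrier}
    (hg : IsChainMap B C g) (hf : IsChainMap A B f) : IsChainMap A C (g ∘ₗ f) :=
  ⟨fun k x hx => hg.map_gr k _ (hf.map_gr k x hx), fun x => by
    rw [LinearMap.comp_apply, hf.map_d, hg.map_d]; rfl⟩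

/-- A map out of a tensor product is a chain map if it is so on tensors of homogeneous elements. -/
theorem of_tmul {f : A.carrier ⊗[R] B.carrier →ₗ[R] C.carrier}
    (hgr : ∀ p q, ∀ x ∈ A.gr p, ∀ y ∈ B.gr q, f (x ⊗ₜ y) ∈ C.gr (p + q))
    (hd : ∀ p q, ∀ x ∈ A.gr p, ∀ y ∈ B.gr q,
      f (A.d x ⊗ₜ y) + (-1 : R) ^ p • f (x ⊗ₜ B.d y) = C.d (f (x ⊗ₜ y))) :
    IsChainMap (A.tensor B) C f where
  map_gr k z hz := by
    induction hz using Submodule.span_induction with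
    | mem z hz =>
      obtain ⟨p, q, rfl, x, hx, y, hy, rfl⟩ := hz
      exact hgr p q x hx y hy
    | zero => simp
    | add a b _ _ iha ihb => rw [map_add]; exact add_mem iha ihb
    | smul r a _ iha => rw [map_smul]; exact Submodule.smul_mem _ _ iha
  map_d := by
    have : f ∘ₗ tensorD A B = C.d ∘ₗ f := tensor_ext fun p q x hx y hy => by
      rw [LinearMap.comp_apply, tensorD_tmul A B hx, map_add, map_smul, hd p q x hx y hy]
      rfl
    exact LinearMap.congr_fun this

theorem map {f : A.carrier →ₗ[R] B.carrier} {g : C.carrier →ₗ[R] D.carrier}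
    (hf : IsChainMap A B f) (hg : IsChainMap C D g) :
    IsChainMap (A.tensor C) (B.tensor D) (TensorProduct.map f g) := by
  refine of_tmul (fun p q x hx y hy => ?_) (fun p q x hx y hy => ?_)
  · exact tmul_mem _ _ rfl (hf.map_gr p x hx) (hg.map_gr q y hy)
  · simp only [TensorProduct.map_tmul]
    rw [tensorD_tmul B D (hf.map_gr p x hx), hf.map_d, hg.map_d]

theorem swap (C D : DGModule R) : IsChainMap (C.tensor D) (D.tensor C) (swap C D) := by
  refine of_tmul (fun p q x hx y hy => ?_) (fun p q x hx y hy => ?_)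
  · rw [swap_tmul C D hx hy]
    exact Submodule.smul_mem _ _ (tmul_mem _ _ (add_comm q p) hy hx)
  -- The sign `(-1) ^ ((p - 1) * q)` is written with exponent `p * q + q`, which has the same
  -- parity. This avoids subtraction and also covers `p = 0`, where the boundary vanishes.
  · have h1 : DGModule.swap C D (C.d x ⊗ₜ y) = (-1 : R) ^ (p * q + q) • (y ⊗ₜ C.d x) := by
      rcases C.d_mem_pred hx with h | ⟨l, rfl, h⟩
      · simp [h]
      · rw [swap_tmul C D h hy, show (l + 1) * q + q = l * q + 2 * q by ring, pow_add, pow_mul]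
        simp
    have h2 : DGModule.swap C D (x ⊗ₜ D.d y) = (-1 : R) ^ (p * q + p) • (D.d y ⊗ₜ x) := by
      rcases D.d_mem_pred hy with h | ⟨l, rfl, h⟩
      · simp [h]
      · rw [swap_tmul C D hx h, show p * (l + 1) + p = p * l + 2 * p by ring, pow_add, pow_mul]
        simp
    rw [h1, h2, swap_tmul C D hx hy, map_smul, tensorD_tmul D C hy, smul_add, smul_smul, smul_smul,
      ← pow_add, ← pow_add, show p + (p * q + p) = p * q + 2 * p by ring, pow_add _ _ (2 * p),
      pow_mul _ 2]
    simp [add_comm]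

theorem assoc (A B C : DGModule R) :
    IsChainMap ((A.tensor B).tensor C) (A.tensor (B.tensor C))
      (TensorProduct.assoc R A.carrier B.carrier C.carrier).toLinearMap := by
  refine of_tmul (fun p q z hz y hy => ?_) (fun p q z hz y hy => ?_)
  · induction hz using Submodule.span_induction with
    | mem z hz =>
      obtain ⟨p, r, rfl, x, hx, w, hw, rfl⟩ := hz
      exact tmul_mem _ _ (by omega) hx (tmul_mem _ _ rfl hw hy)
    | zero => simp
    | add a b _ _ iha ihb => rw [TensorProduct.add_tmul, map_add]; exact add_mem iha ihb
    | smul r a _ iha =>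
      rw [← TensorProduct.smul_tmul', map_smul]; exact Submodule.smul_mem _ _ iha
  · induction hz using Submodule.span_induction with
    | mem z hz =>
      obtain ⟨p, r, rfl, x, hx, w, hw, rfl⟩ := hz
      simp only [tensorD_tmul A B hx, TensorProduct.add_tmul, LinearEquiv.coe_coe, map_add,
        TensorProduct.assoc_tmul, ← TensorProduct.smul_tmul', map_smul]
      rw [tensorD_tmul A _ hx, tensorD_tmul B C hw, TensorProduct.tmul_add, TensorProduct.tmul_smul,
        smul_add, smul_smul, pow_add, add_assoc]
    | zero => simp
    | add a b _ _ iha ihb =>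
      simp only [TensorProduct.add_tmul, map_add] at iha ihb ⊢
      rw [← iha, ← ihb, smul_add]; abel
    | smul r a _ iha =>
      simp only [← TensorProduct.smul_tmul', map_smul] at iha ⊢
      rw [← iha, smul_add, smul_comm r]

theorem assoc_symm (A B C : DGModule R) :
    IsChainMap (A.tensor (B.tensor C)) ((A.tensor B).tensor C)
      (TensorProduct.assoc R A.carrier B.carrier C.carrier).symm.toLinearMap where
  map_gr k z hz := by
    induction hz using Submodule.span_induction with
    | mem z hz =>
      obtain ⟨p, q, rfl, x, hx, w, hw, rfl⟩ := hz
      induction hw using Submodule.span_induction with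
      | mem w hw =>
        obtain ⟨q, r, rfl, y, hy, w, hw, rfl⟩ := hw
        exact tmul_mem _ _ (add_assoc p q r) (tmul_mem _ _ rfl hx hy) hw
      | zero => simp
      | add a b _ _ iha ihb => rw [TensorProduct.tmul_add, map_add]; exact add_mem iha ihb
      | smul r a _ iha =>
        rw [TensorProduct.tmul_smul, map_smul]; exact Submodule.smul_mem _ _ iha
    | zero => simp
    | add a b _ _ iha ihb => rw [map_add]; exact add_mem iha ihb
    | smul r a _ iha => rw [map_smul]; exact Submodule.smul_mem _ _ iha
  map_d x := by
    have := (assoc A B C).map_d ((TensorProduct.assoc R A.carrier B.carrier C.carrier).symm x)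
    simp only [LinearEquiv.coe_coe, LinearEquiv.apply_symm_apply] at this ⊢
    rw [← this, LinearEquiv.symm_apply_apply]

/-- The interchange is a composite of associators and one transposition, so no further sign has to
be checked. -/
theorem interchange (A B C D : DGModule R) :
    IsChainMap ((A.tensor B).tensor (C.tensor D)) ((A.tensor C).tensor (B.tensor D))
      (interchange A B C D) :=
  (assoc_symm A C (B.tensor D)).comp <|
    ((id A).map ((assoc C B D).comp (((swap B C).map (id D)).comp (assoc_symm B C D)))).comp <|
      assoc A B (C.tensor D)

end IsChainMap

/-- The transposition of the first two factors of `C ⊗ (D ⊗ E)`. -/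
def leftSwap (C D E : DGModule R) :
    C.carrier ⊗[R] (D.carrier ⊗[R] E.carrier) →ₗ[R] D.carrier ⊗[R] (C.carrier ⊗[R] E.carrier) :=
  (TensorProduct.assoc R D.carrier C.carrier E.carrier).toLinearMap ∘ₗ
    TensorProduct.map (swap C D) LinearMap.id ∘ₗ
    (TensorProduct.assoc R C.carrier D.carrier E.carrier).symm.toLinearMap

theorem leftSwap_tmul (C D E : DGModule R) {p q : ℕ} {x : C.carrier} {y : D.carrier}
    (hx : x ∈ C.gr p) (hy : y ∈ D.gr q) (z : E.carrier) :
    leftSwap C D E (x ⊗ₜ (y ⊗ₜ z)) = (-1 : R) ^ (p * q) • (y ⊗ₜ[R] (x ⊗ₜ[R] z)) := by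
  simp only [leftSwap, LinearMap.comp_apply, LinearEquiv.coe_coe, TensorProduct.assoc_symm_tmul,
    TensorProduct.map_tmul, swap_tmul C D hx hy, LinearMap.id_apply]
  rw [← TensorProduct.smul_tmul', map_smul]
  rfl

theorem IsChainMap.leftSwap (C D E : DGModule R) :
    IsChainMap (C.tensor (D.tensor E)) (D.tensor (C.tensor E)) (leftSwap C D E) :=
  (IsChainMap.assoc D C E).comp <| ((IsChainMap.swap C D).map (IsChainMap.id E)).comp <|
    IsChainMap.assoc_symm C D E

/-! ## Contractions -/

/-- A contraction of a differential graded module with augmentation `ε` onto a point. -/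
structure Contraction (C : DGModule R) (ε : C.carrier →ₗ[R] R) where
  h : C.carrier →ₗ[R] C.carrier
  pt : C.carrier
  h_mem : ∀ k, ∀ x ∈ C.gr k, h x ∈ C.gr (k + 1)
  pt_mem : pt ∈ C.gr 0
  d_h : ∀ x, C.d (h x) = x - h (C.d x) - ε x • pt
  h_h : ∀ x, h (h x) = 0
  h_pt : h pt = 0
  aug_h : ∀ x, ε (h x) = 0
  aug_pt : ε pt = 1
  aug_gr : ∀ k, ∀ x ∈ C.gr (k + 1), ε x = 0

namespace Contraction

variable {C D E : DGModule R} {ε : C.carrier →ₗ[R] R} {ε' : D.carrier →ₗ[R] R}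
  {ε'' : E.carrier →ₗ[R] R}

theorem d_pt (κ : Contraction C ε) : C.d κ.pt = 0 := C.d_zero _ κ.pt_mem

theorem eq_add (κ : Contraction C ε) (x : C.carrier) :
    x = C.d (κ.h x) + κ.h (C.d x) + ε x • κ.pt := by
  rw [κ.d_h]; abel

/-- Compatibility of `ε` with `d` is not a field of `Contraction`; it follows from the homotopy
formula. Applying `ε` to that formula gives `ε (d (h y)) = ε y - ε y`, and `d x = d (h (d x))`. -/
theorem aug_d (κ : Contraction C ε) (x : C.carrier) : ε (C.d x) = 0 := by
  have key (y : C.carrier) : ε (C.d (κ.h y)) = 0 := by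
    rw [κ.d_h]; simp [κ.aug_h, κ.aug_pt]
  rw [κ.eq_add x]
  simp [C.d_d, key, κ.d_pt]

/-- An element which the contraction kills is determined by its boundary and augmentation. -/
theorem eq_of_h_eq_zero (κ : Contraction C ε) {x : C.carrier} (hx : κ.h x = 0) :
    x = κ.h (C.d x) + ε x • κ.pt := by
  conv_lhs => rw [κ.eq_add x, hx, map_zero, zero_add]

/-- The augmentation of a tensor product. -/
def _root_.DGModule.tensorAug (ε : C.carrier →ₗ[R] R) (ε' : D.carrier →ₗ[R] R) :
    C.carrier ⊗[R] D.carrier →ₗ[R] R :=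
  LinearMap.mul' R R ∘ₗ TensorProduct.map ε ε'

@[simp]
theorem _root_.DGModule.tensorAug_tmul (ε : C.carrier →ₗ[R] R) (ε' : D.carrier →ₗ[R] R)
    (x : C.carrier) (y : D.carrier) : tensorAug ε ε' (x ⊗ₜ y) = ε x * ε' y := rfl

/-- The homotopy `h ⊗ 1 + pt ε ⊗ h` on a tensor product. -/
def tensorH (κ : Contraction C ε) (κ' : Contraction D ε') :
    C.carrier ⊗[R] D.carrier →ₗ[R] C.carrier ⊗[R] D.carrier :=
  TensorProduct.map κ.h LinearMap.id +
    TensorProduct.map (LinearMap.toSpanSingleton R _ κ.pt ∘ₗ ε) κ'.h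

@[simp]
theorem tensorH_tmul (κ : Contraction C ε) (κ' : Contraction D ε') (x : C.carrier)
    (y : D.carrier) : κ.tensorH κ' (x ⊗ₜ y) = κ.h x ⊗ₜ y + ε x • (κ.pt ⊗ₜ[R] κ'.h y) := by
  simp [tensorH, TensorProduct.smul_tmul']

theorem d_tensorH (κ : Contraction C ε) (κ' : Contraction D ε') (z : C.carrier ⊗[R] D.carrier) :
    tensorD C D (κ.tensorH κ' z) =
      z - κ.tensorH κ' (tensorD C D z) - tensorAug ε ε' z • (κ.pt ⊗ₜ κ'.pt) := by
  have : tensorD C D ∘ₗ κ.tensorH κ' = LinearMap.id - κ.tensorH κ' ∘ₗ tensorD C D -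
      LinearMap.toSpanSingleton R _ (κ.pt ⊗ₜ κ'.pt) ∘ₗ tensorAug ε ε' := by
    refine tensor_ext fun p q x hx y hy => ?_
    -- The Koszul sign disappears next to `ε x`, because `ε` vanishes in positive dimensions.
    have hs : (-1 : R) ^ p * ε x = ε x := by
      cases p with
      | zero => simp
      | succ p => simp [κ.aug_gr p x hx]
    simp only [LinearMap.comp_apply, LinearMap.sub_apply, LinearMap.id_apply, tensorH_tmul,
      map_add, map_smul, tensorD_tmul C D hx, tensorD_tmul C D (κ.h_mem p x hx),
      tensorD_tmul C D κ.pt_mem, κ.d_h, κ'.d_h, κ.d_pt, κ.aug_d, tensorAug_tmul,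
      LinearMap.toSpanSingleton_apply, TensorProduct.sub_tmul, TensorProduct.tmul_sub,
      smul_sub, smul_add, smul_smul, hs, TensorProduct.zero_tmul, TensorProduct.tmul_smul,
      ← TensorProduct.smul_tmul', pow_succ, zero_smul, pow_zero, one_smul, mul_neg, mul_one,
      neg_smul, smul_zero, one_mul]
    abel
  exact LinearMap.congr_fun this z

theorem tensorH_mem (κ : Contraction C ε) (κ' : Contraction D ε') (k : ℕ) :
    ∀ z ∈ tensorGr C D k, κ.tensorH κ' z ∈ tensorGr C D (k + 1) := by
  intro z hz
  induction hz using Submodule.span_induction with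
  | mem z hz =>
    obtain ⟨p, q, rfl, x, hx, y, hy, rfl⟩ := hz
    rw [tensorH_tmul]
    refine add_mem (tmul_mem _ _ (by omega) (κ.h_mem p x hx) hy) ?_
    cases p with
    | zero =>
      exact Submodule.smul_mem _ _ (tmul_mem _ _ (by omega) κ.pt_mem (κ'.h_mem q y hy))
    | succ p => simp [κ.aug_gr p x hx]
  | zero => simp
  | add a b _ _ iha ihb => rw [map_add]; exact add_mem iha ihb
  | smul r a _ iha => rw [map_smul]; exact Submodule.smul_mem _ _ iha

theorem tensorH_tensorH (κ : Contraction C ε) (κ' : Contraction D ε')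
    (z : C.carrier ⊗[R] D.carrier) : κ.tensorH κ' (κ.tensorH κ' z) = 0 := by
  have : κ.tensorH κ' ∘ₗ κ.tensorH κ' = 0 := by
    refine tensor_ext fun p q x _ y _ => ?_
    simp [κ.h_h, κ'.h_h, κ.aug_h, κ.h_pt]
  exact LinearMap.congr_fun this z

theorem tensorAug_tensorH (κ : Contraction C ε) (κ' : Contraction D ε')
    (z : C.carrier ⊗[R] D.carrier) : tensorAug ε ε' (κ.tensorH κ' z) = 0 := by
  have : tensorAug ε ε' ∘ₗ κ.tensorH κ' = 0 := by
    refine tensor_ext fun p q x _ y _ => ?_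
    simp [κ.aug_h, κ'.aug_h]
  exact LinearMap.congr_fun this z

theorem tensorAug_of_mem (κ : Contraction C ε) (κ' : Contraction D ε') (k : ℕ) :
    ∀ z ∈ tensorGr C D (k + 1), tensorAug ε ε' z = 0 := by
  intro z hz
  induction hz using Submodule.span_induction with
  | mem z hz =>
    obtain ⟨p, q, h, x, hx, y, hy, rfl⟩ := hz
    rw [tensorAug_tmul]
    cases p with
    | zero =>
      cases q with
      | zero => omega
      | succ q => simp [κ'.aug_gr q y hy]
    | succ p => simp [κ.aug_gr p x hx]
  | zero => simp
  | add a b _ _ iha ihb => rw [map_add, iha, ihb, add_zero]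
  | smul r a _ iha => rw [map_smul, iha, smul_zero]

/-- The contraction of a tensor product. -/
def tensor (κ : Contraction C ε) (κ' : Contraction D ε') :
    Contraction (C.tensor D) (tensorAug ε ε') where
  h := κ.tensorH κ'
  pt := κ.pt ⊗ₜ κ'.pt
  h_mem := tensorH_mem κ κ'
  pt_mem := tmul_mem C D (add_zero 0) κ.pt_mem κ'.pt_mem
  d_h := d_tensorH κ κ'
  h_h := tensorH_tensorH κ κ'
  h_pt := (tensorH_tmul κ κ' _ _).trans (by simp [κ.h_pt, κ'.h_pt])
  aug_h := tensorAug_tensorH κ κ'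
  aug_pt := (tensorAug_tmul ε ε' _ _).trans (by simp [κ.aug_pt, κ'.aug_pt])
  aug_gr := tensorAug_of_mem κ κ'

@[simp]
theorem tensor_h_tmul (κ : Contraction C ε) (κ' : Contraction D ε') (x : C.carrier)
    (y : D.carrier) : (κ.tensor κ').h (x ⊗ₜ y) = κ.h x ⊗ₜ y + ε x • (κ.pt ⊗ₜ[R] κ'.h y) :=
  tensorH_tmul κ κ' x y

/-- Maps that commute with augmentations, base points and homotopies. -/
structure IsHom (κ : Contraction C ε) (κ' : Contraction D ε') (f : C.carrier →ₗ[R] D.carrier) :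
    Prop where
  map_h : ∀ x, f (κ.h x) = κ'.h (f x)
  map_pt : f κ.pt = κ'.pt
  map_aug : ∀ x, ε' (f x) = ε x

namespace IsHom

theorem id (κ : Contraction C ε) : κ.IsHom κ LinearMap.id := ⟨fun _ => rfl, rfl, fun _ => rfl⟩

theorem comp {κ : Contraction C ε} {κ' : Contraction D ε'} {κ'' : Contraction E ε''}
    {g : D.carrier →ₗ[R] E.carrier} {f : C.carrier →ₗ[R] D.carrier}
    (hg : κ'.IsHom κ'' g) (hf : κ.IsHom κ' f) : κ.IsHom κ'' (g ∘ₗ f) where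
  map_h x := by simp [hf.map_h, hg.map_h]
  map_pt := by simp [hf.map_pt, hg.map_pt]
  map_aug x := by simp [hf.map_aug, hg.map_aug]

theorem map {C' D' : DGModule R} {ε₁ : C'.carrier →ₗ[R] R} {ε₂ : D'.carrier →ₗ[R] R}
    {κ : Contraction C ε} {κ' : Contraction D ε'} {κ₁ : Contraction C' ε₁}
    {κ₂ : Contraction D' ε₂} {f : C.carrier →ₗ[R] C'.carrier} {g : D.carrier →ₗ[R] D'.carrier}
    (hf : κ.IsHom κ₁ f) (hg : κ'.IsHom κ₂ g) :
    (κ.tensor κ').IsHom (κ₁.tensor κ₂) (TensorProduct.map f g) where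
  map_h := by
    have : TensorProduct.map f g ∘ₗ κ.tensorH κ' = κ₁.tensorH κ₂ ∘ₗ TensorProduct.map f g :=
      tensor_ext fun p q x _ y _ => by
        simp [hf.map_h, hg.map_h, hf.map_pt, hf.map_aug]
    exact LinearMap.congr_fun this
  map_pt := congrArg₂ (fun x y => x ⊗ₜ[R] y) hf.map_pt hg.map_pt
  map_aug := by
    have : tensorAug ε₁ ε₂ ∘ₗ TensorProduct.map f g = tensorAug ε ε' :=
      tensor_ext fun p q x _ y _ => by simp [hf.map_aug, hg.map_aug]
    exact LinearMap.congr_fun this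

/-- Both bracketings give the homotopy `h ⊗ 1 ⊗ 1 + pt ε ⊗ h ⊗ 1 + pt ε ⊗ pt ε ⊗ h`. This strict
associativity is what makes the coproduct strictly coassociative. -/
theorem assoc (κ : Contraction C ε) (κ' : Contraction D ε') (κ'' : Contraction E ε'') :
    ((κ.tensor κ').tensor κ'').IsHom (κ.tensor (κ'.tensor κ''))
      (TensorProduct.assoc R C.carrier D.carrier E.carrier).toLinearMap where
  map_h := by
    have : (TensorProduct.assoc R C.carrier D.carrier E.carrier).toLinearMap ∘ₗ
        (κ.tensor κ').tensorH κ'' = κ.tensorH (κ'.tensor κ'') ∘ₗ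
        (TensorProduct.assoc R C.carrier D.carrier E.carrier).toLinearMap := by
      refine TensorProduct.ext_threefold fun x y z => ?_
      rw [LinearMap.comp_apply, LinearMap.comp_apply, LinearEquiv.coe_coe,
        TensorProduct.assoc_tmul]
      rw [tensorH_tmul, tensorH_tmul, tensor_h_tmul, tensor_h_tmul]
      simp only [map_add, TensorProduct.add_tmul, TensorProduct.tmul_add,
        ← TensorProduct.smul_tmul', map_smul, tensorAug_tmul, TensorProduct.tmul_smul, smul_add,
        smul_smul, add_assoc]
      rfl
    exact LinearMap.congr_fun this
  map_pt := rfl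
  map_aug := by
    have : tensorAug (D := D.tensor E) ε (tensorAug ε' ε'') ∘ₗ
        (TensorProduct.assoc R C.carrier D.carrier E.carrier).toLinearMap =
          tensorAug (C := C.tensor D) (tensorAug ε ε') ε'' :=
      TensorProduct.ext_threefold fun x y z => (mul_assoc (ε x) (ε' y) (ε'' z)).symm
    exact LinearMap.congr_fun this

end IsHom

end Contraction

/-! ## Acyclic carriers -/

/-- A family `b` of homogeneous elements, of dimensions `deg`, that spans `C`. -/
structure Generates (C : DGModule R) {ι : Type} (deg : ι → ℕ) (b : ι → C.carrier) : Prop where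
  mem : ∀ i, b i ∈ C.gr (deg i)
  le_span : ∀ k, C.gr k ≤ Submodule.span R (b '' {i | deg i = k})

namespace Generates

variable {C D : DGModule R} {ι ι' : Type} {deg : ι → ℕ} {b : ι → C.carrier} {deg' : ι' → ℕ}
  {b' : ι' → D.carrier}

theorem ext_gr (hb : C.Generates deg b) {M : Type} [AddCommGroup M] [Module R M]
    {f g : C.carrier →ₗ[R] M} {k : ℕ} (h : ∀ i, deg i = k → f (b i) = g (b i)) {x : C.carrier}
    (hx : x ∈ C.gr k) : f x = g x := by
  refine LinearMap.eqOn_span (s := b '' {i | deg i = k}) ?_ (hb.le_span k hx)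
  rintro _ ⟨i, hi, rfl⟩
  exact h i hi

theorem ext (hb : C.Generates deg b) {M : Type} [AddCommGroup M] [Module R M]
    {f g : C.carrier →ₗ[R] M} (h : ∀ i, f (b i) = g (b i)) : f = g := by
  ext x
  induction x using DirectSum.Decomposition.inductionOn C.gr with
  | zero => simp
  | add x y hx hy => simp [hx, hy]
  | homogeneous x => exact hb.ext_gr (fun i _ => h i) x.2

theorem tensor (hb : C.Generates deg b) (hb' : D.Generates deg' b') :
    (C.tensor D).Generates (fun i : ι × ι' => deg i.1 + deg' i.2)
      (fun i => b i.1 ⊗ₜ[R] b' i.2) where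
  mem i := tmul_mem _ _ rfl (hb.mem _) (hb'.mem _)
  le_span k := by
    refine Submodule.span_le.2 ?_
    rintro _ ⟨p, q, rfl, x, hx, y, hy, rfl⟩
    have := Submodule.apply_mem_map₂ (TensorProduct.mk R _ _) (hb.le_span p hx) (hb'.le_span q hy)
    rw [Submodule.map₂_span_span] at this
    refine Submodule.span_mono ?_ this
    rintro _ ⟨_, ⟨i, hi, rfl⟩, _, ⟨j, hj, rfl⟩, rfl⟩
    exact ⟨(i, j), congrArg₂ (· + ·) hi hj, rfl⟩

/-- Chain maps with the same augmentation agree if they send every generator to an element which is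
killed by a suitable contraction. -/
theorem chainMap_unique (hb : C.Generates deg b) {ε : D.carrier →ₗ[R] R}
    (κ : ι → Contraction D ε) {f g : C.carrier →ₗ[R] D.carrier} (hf : IsChainMap C D f)
    (hg : IsChainMap C D g) (hfκ : ∀ i, (κ i).h (f (b i)) = 0) (hgκ : ∀ i, (κ i).h (g (b i)) = 0)
    (haug : ∀ i, deg i = 0 → ε (f (b i)) = ε (g (b i))) : f = g := by
  have key : ∀ k, ∀ i, deg i = k → f (b i) = g (b i) := by
    intro k
    induction k with
    | zero =>
      intro i hi
      have h0 : C.d (b i) = 0 := C.d_zero _ (hi ▸ hb.mem i)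
      rw [(κ i).eq_of_h_eq_zero (hfκ i), (κ i).eq_of_h_eq_zero (hgκ i), haug i hi, ← hf.map_d,
        ← hg.map_d, h0]
      simp
    | succ k ih =>
      intro i hi
      have hi' : b i ∈ C.gr (k + 1) := hi ▸ hb.mem i
      -- In positive dimension the augmentation terms vanish, and the boundaries agree by the
      -- induction hypothesis.
      rw [(κ i).eq_of_h_eq_zero (hfκ i), (κ i).eq_of_h_eq_zero (hgκ i),
        (κ i).aug_gr k _ (hf.map_gr _ _ hi'), (κ i).aug_gr k _ (hg.map_gr _ _ hi'), ← hf.map_d,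
        ← hg.map_d, hb.ext_gr ih (C.d_mem k _ hi')]
  exact hb.ext fun i => key _ i rfl

end Generates

/-- The approximations to the chain map that is carried by the contractions `κ`. -/
def carriedAux {C D : DGModule R} {ι : Type} (b : Module.Basis ι R C.carrier)
    (ε : C.carrier →ₗ[R] R) {ε' : D.carrier →ₗ[R] R} (κ : ι → Contraction D ε') :
    ℕ → (C.carrier →ₗ[R] D.carrier)
  | 0 => b.constr R fun i => ε (b i) • (κ i).pt
  | k + 1 => b.constr R fun i => (κ i).h (carriedAux b ε κ k (C.d (b i))) + ε (b i) • (κ i).pt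

/-- The chain map that is carried by the contractions `κ`. -/
def carried {C D : DGModule R} {ι : Type} (b : Module.Basis ι R C.carrier) (deg : ι → ℕ)
    (ε : C.carrier →ₗ[R] R) {ε' : D.carrier →ₗ[R] R} (κ : ι → Contraction D ε') :
    C.carrier →ₗ[R] D.carrier :=
  b.constr R fun i => carriedAux b ε κ (deg i) (b i)

/-! ### Existence of the carried chain map -/

section Carried

variable {C D : DGModule R} {ι : Type} {b : Module.Basis ι R C.carrier} {deg : ι → ℕ}
  {ε : C.carrier →ₗ[R] R} {ε' : D.carrier →ₗ[R] R} (κ : ι → Contraction D ε')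

/-- Replacing the approximation of level `k` by the final map is harmless, since only its values in
dimension `k` enter. This is the recursion from which all properties of the carried map are read
off. -/
theorem carried_basis (hb : C.Generates deg b) (i : ι) :
    carried b deg ε κ (b i) = (κ i).h (carried b deg ε κ (C.d (b i))) + ε (b i) • (κ i).pt := by
  rw [carried, Module.Basis.constr_basis]
  rcases hk : deg i with _ | k
  · have h0 : C.d (b i) = 0 := C.d_zero _ (hk ▸ hb.mem i)
    simp [carriedAux, h0]
  · rw [carriedAux, Module.Basis.constr_basis]
    congr 2
    -- On generators of dimension `k` the carried map is by definition the `k`-th approximation.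
    refine hb.ext_gr (fun j hj => ?_) (C.d_mem k _ (hk ▸ hb.mem i))
    rw [Module.Basis.constr_basis, hj]

theorem h_carried_basis (hb : C.Generates deg b) (i : ι) :
    (κ i).h (carried b deg ε κ (b i)) = 0 := by
  rw [carried_basis κ hb, map_add, map_smul, (κ i).h_h, (κ i).h_pt, smul_zero, add_zero]

theorem aug_carried (hb : C.Generates deg b) (x : C.carrier) :
    ε' (carried b deg ε κ x) = ε x := by
  have : ε' ∘ₗ carried b deg ε κ = ε := b.ext fun i => by
    rw [LinearMap.comp_apply, carried_basis κ hb, map_add, (κ i).aug_h, map_smul, (κ i).aug_pt]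
    simp
  exact LinearMap.congr_fun this x

/-- By induction `d (f (d b)) = f (d (d b)) = 0`, so `f (d b)` is a cycle of augmentation zero. For
such a cycle the homotopy formula reads `d (h (f (d b))) = f (d b)`, and `h (f (d b))` is the value
of `f` at `b`. -/
theorem carried_chainMap (hb : C.Generates deg b) (hd : ∀ x, ε (C.d x) = 0)
    (hgr : ∀ i, deg i ≠ 0 → ε (b i) = 0) : IsChainMap C D (carried b deg ε κ) := by
  set f := carried b deg ε κ with hf
  have key : ∀ k, ∀ i, deg i = k → f (b i) ∈ D.gr k ∧ f (C.d (b i)) = D.d (f (b i)) := by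
    intro k
    induction k with
    | zero =>
      intro i hi
      have h0 : C.d (b i) = 0 := C.d_zero _ (hi ▸ hb.mem i)
      rw [hf, carried_basis κ hb, h0, map_zero, map_zero, zero_add, map_smul, (κ i).d_pt,
        smul_zero]
      exact ⟨Submodule.smul_mem _ _ (κ i).pt_mem, rfl⟩
    | succ k ih =>
      intro i hi
      have hi' : C.d (b i) ∈ C.gr k := C.d_mem k _ (hi ▸ hb.mem i)
      have h1 : f (C.d (b i)) ∈ D.gr k := by
        have : C.gr k ≤ (D.gr k).comap f := (hb.le_span k).trans <| Submodule.span_le.2 <| by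
          rintro _ ⟨j, hj, rfl⟩
          exact (ih j hj).1
        exact this hi'
      have h2 : D.d (f (C.d (b i))) = 0 := by
        have := hb.ext_gr (f := f ∘ₗ C.d) (g := D.d ∘ₗ f) (fun j hj => (ih j hj).2) hi'
        rw [LinearMap.comp_apply, LinearMap.comp_apply, C.d_d, map_zero] at this
        exact this.symm
      have h3 : f (b i) = (κ i).h (f (C.d (b i))) := by
        rw [hf, carried_basis κ hb, hgr i (by omega), zero_smul, add_zero]
      rw [h3]
      refine ⟨(κ i).h_mem k _ h1, ?_⟩
      rw [(κ i).d_h, h2, hf, aug_carried κ hb, hd]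
      simp
  refine ⟨fun k => ?_, fun x => ?_⟩
  · change C.gr k ≤ (D.gr k).comap f
    refine (hb.le_span k).trans <| Submodule.span_le.2 ?_
    rintro _ ⟨j, hj, rfl⟩
    exact (key k j hj).1
  · have : f ∘ₗ C.d = D.d ∘ₗ f := b.ext fun i => (key _ i rfl).2
    exact LinearMap.congr_fun this x

end Carried

end DGModule

end ChainMaps

/-! ## Cones in the bar resolution -/

section BarCone

variable {R G H K : Type} [CommRing R] [Group G] [Group H] [Group K]

open DGModule

theorem bar_eq_zero (g : G) {l : List G} (h : 1 ∈ l) : (bar g l : BarModule R G) = 0 := by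
  simp [bar, h]

theorem barAug_bar_eq (g : G) (l : List G) :
    barAug (bar g l : BarModule R G) = if l = [] then 1 else 0 := by
  by_cases h : (1 : G) ∈ l
  · rw [bar_eq_zero g h, map_zero, if_neg (List.ne_nil_of_mem h)]
  · simp [barAug_bar g l h]

theorem barAct_mem (a : G) (k : ℕ) :
    ∀ x ∈ barGr (R := R) (G := G) k, barAct a x ∈ barGr (R := R) (G := G) k := by
  intro x hx
  rw [barGr, Finsupp.supported_eq_span_single] at hx
  induction hx using Submodule.span_induction with
  | mem z hz =>
    obtain ⟨⟨g, l, hl⟩, hx, rfl⟩ := hz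
    have : (Finsupp.single (g, ⟨l, hl⟩) 1 : BarModule R G) = bar g l := by simp [bar, hl]
    change barAct a (Finsupp.single (g, ⟨l, hl⟩) 1) ∈ _
    rw [this, barAct_bar]
    exact bar_mem_barGr (a * g) l fun _ => hx
  | zero => simp
  | add a b _ _ iha ihb => rw [map_add]; exact add_mem iha ihb
  | smul r a _ iha => rw [map_smul]; exact Submodule.smul_mem _ _ iha

theorem barAct_isChainMap (a : G) :
    IsChainMap (barResolution R G) (barResolution R G) (barAct a) :=
  ⟨barAct_mem a, fun x => (barD_act a x).symm⟩

theorem barPhi_mem (k : ℕ) :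
    ∀ x ∈ barGr (R := R) (G := G) k, barPhi x ∈ barGr (R := R) (G := G) (k + 1) := by
  intro x hx
  unfold barPhi
  rw [Finsupp.linearCombination_apply]
  exact Submodule.sum_mem _ fun y hy => Submodule.smul_mem _ _ <|
    bar_mem_barGr _ _ fun _ => congrArg (· + 1) (hx hy)

theorem barAug_of_mem (k : ℕ) :
    ∀ x ∈ barGr (R := R) (G := G) (k + 1), barAug x = 0 := by
  intro x hx
  unfold barAug
  rw [Finsupp.linearCombination_apply]
  refine Finset.sum_eq_zero fun y hy => ?_
  have hy' : y.2.1.length = k + 1 := hx hy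
  simp [hy']

theorem barAct_inv_act (a : G) (x : BarModule R G) : barAct a⁻¹ (barAct a x) = x := by
  rw [← Module.End.mul_apply, ← map_mul]; simp

theorem barAct_act_inv (a : G) (x : BarModule R G) : barAct a (barAct a⁻¹ x) = x := by
  rw [← Module.End.mul_apply, ← map_mul]; simp

/-- The contraction of the bar resolution onto the vertex `g`. -/
def barCone (g : G) : Contraction (barResolution R G) barAug where
  h := barAct g ∘ₗ barPhi ∘ₗ barAct g⁻¹
  pt := bar g []
  h_mem k x hx := barAct_mem _ _ _ (barPhi_mem _ _ (barAct_mem _ _ _ hx))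
  pt_mem := bar_mem_barGr g [] fun _ => rfl
  d_h x := by
    simp only [LinearMap.comp_apply]
    rw [barD_act, barD_barPhi, map_sub, map_sub, map_smul, barAct_act_inv, barD_act, barAug_act,
      barAct_bar, mul_one]
  h_h x := by
    simp only [LinearMap.comp_apply]
    rw [barAct_inv_act, barPhi_barPhi, map_zero]
  h_pt := by
    simp only [LinearMap.comp_apply]
    rw [barAct_bar, barPhi_bar, inv_mul_cancel, bar_eq_zero _ (by simp), map_zero]
  aug_h x := by
    simp only [LinearMap.comp_apply]
    rw [barAug_act, barAug_barPhi]
  aug_pt := by simp [barAug_bar_eq]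
  aug_gr := barAug_of_mem

theorem barCone_h_bar (g a : G) (l : List G) :
    (barCone g).h (bar a l : BarModule R G) = bar g (g⁻¹ * a :: l) := by
  change barAct g (barPhi (barAct g⁻¹ (bar a l))) = _
  rw [barAct_bar, barPhi_bar, barAct_bar, mul_one]

/-- Every basis element is an iterated cone on a vertex. Inductions over the list of entries rest on
this, with the vertex left arbitrary because it changes from `g` to `g * a`. -/
theorem bar_cons (g a : G) (l : List G) :
    (bar g (a :: l) : BarModule R G) = (barCone g).h (bar (g * a) l) := by
  rw [barCone_h_bar, inv_mul_cancel_left]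

theorem barCone_h_bar_self (g : G) (l : List G) :
    (barCone g).h (bar g l : BarModule R G) = 0 := by
  rw [barCone_h_bar, inv_mul_cancel, bar_eq_zero _ (by simp)]

theorem barCone_h_mem_span (g : G) (x : BarModule R G) :
    (barCone g).h x ∈ Submodule.span R (Set.range fun l : List G => (bar g l : BarModule R G)) := by
  induction x using Finsupp.induction_linear with
  | zero => simp
  | add x y hx hy => rw [map_add]; exact add_mem hx hy
  | single x r =>
    obtain ⟨a, l, hl⟩ := x
    have : (Finsupp.single (a, ⟨l, hl⟩) r : BarModule R G) = r • bar a l := by simp [bar, hl]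
    rw [this, map_smul, barCone_h_bar]
    exact Submodule.smul_mem _ _ (Submodule.subset_span ⟨_, rfl⟩)

/-- The cone at `g` kills exactly the combinations of the elements `g[a₁|…|aₖ]`. -/
theorem barCone_h_eq_zero_iff (g : G) (x : BarModule R G) : (barCone g).h x = 0 ↔
    x ∈ Submodule.span R (Set.range fun l : List G => (bar g l : BarModule R G)) := by
  constructor
  · intro h
    -- An element killed by the cone is itself a cone plus a multiple of the vertex `g[]`.
    rw [(barCone g).eq_of_h_eq_zero h]
    exact add_mem (barCone_h_mem_span g _)
      (Submodule.smul_mem _ _ (Submodule.subset_span ⟨[], rfl⟩))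
  · intro h
    induction h using Submodule.span_induction with
    | mem z hz =>
      obtain ⟨l, rfl⟩ := hz
      exact barCone_h_bar_self g l
    | zero => simp
    | add a b _ _ iha ihb => rw [map_add, iha, ihb, add_zero]
    | smul r a _ iha => rw [map_smul, iha, smul_zero]

/-- This puts the condition on `A(G, 1)` into the form that `chainMap_unique` uses. -/
theorem mem_barA_iff (x : BarModule R G) : x ∈ barA (R := R) (G := G) ↔ (barCone 1).h x = 0 :=
  (barCone_h_eq_zero_iff 1 x).symm

/-! ## Maps out of the bar resolution -/

/-- Dimensions of the basis elements of the bar resolution. -/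
def barDeg (x : G × {l : List G // 1 ∉ l}) : ℕ := x.2.1.length

/-- The basis of the bar resolution. -/
def barBasis (R G : Type) [CommRing R] [Group G] :
    Module.Basis (G × {l : List G // 1 ∉ l}) R (barResolution R G).carrier :=
  Finsupp.basisSingleOne

theorem barBasis_apply (x : G × {l : List G // 1 ∉ l}) :
    barBasis R G x = bar x.1 x.2.1 := by
  simp [barBasis, bar, x.2.2]

theorem barBasis_generates : (barResolution R G).Generates barDeg (barBasis R G) where
  mem x := by rw [barBasis_apply]; exact bar_mem_barGr _ _ fun _ => rfl
  le_span k := by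
    change Finsupp.supported R R {x : G × {l : List G // 1 ∉ l} | x.2.1.length = k} ≤ _
    rw [Finsupp.supported_eq_span_single]
    refine Submodule.span_mono ?_
    rintro _ ⟨x, hx, rfl⟩
    exact ⟨x, hx, by simp [barBasis]⟩

/-! ### Maps that commute with cones -/

section Hom

variable {D : DGModule R} {ε : D.carrier →ₗ[R] R} {κ : G → Contraction D ε}
  {f f' : BarModule R G →ₗ[R] D.carrier}

/-- A map out of the bar resolution that commutes with cones is a chain map. -/
theorem isChainMap_of_barCone_isHom
    (hf : ∀ g, (barCone (R := R) g).IsHom (κ g) f) : IsChainMap (barResolution R G) D f := by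
  have hgr : ∀ (l : List G) (g : G), f (bar g l) ∈ D.gr l.length := by
    intro l
    induction l with
    | nil => intro g; exact (hf g).map_pt ▸ (κ g).pt_mem
    | cons a l ih =>
      intro g
      rw [bar_cons, (hf g).map_h]
      exact (κ g).h_mem _ _ (ih _)
  have hd : ∀ (l : List G) (g : G), f (barD (bar g l)) = D.d (f (bar g l)) := by
    intro l
    induction l with
    | nil =>
      intro g
      have h1 : f (bar g []) = (κ g).pt := (hf g).map_pt
      rw [h1, (κ g).d_pt, barD_zero _ (bar_mem_barGr _ _ fun _ => rfl), map_zero]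
    | cons a l ih =>
      intro g
      have h1 : f (bar g []) = (κ g).pt := (hf g).map_pt
      have h2 : barD ((barCone g).h (bar (g * a) l : BarModule R G)) =
        bar (g * a) l - (barCone g).h (barD (bar (g * a) l)) - barAug (bar (g * a) l) • bar g [] :=
        (barCone g).d_h _
      rw [bar_cons, (hf g).map_h, (κ g).d_h, h2, map_sub, map_sub, (hf g).map_h, ih, map_smul, h1,
        (hf g).map_aug]
  refine ⟨fun k => ?_, fun x => ?_⟩
  · change barGr k ≤ (D.gr k).comap f
    refine (barBasis_generates.le_span k).trans <| Submodule.span_le.2 ?_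
    rintro _ ⟨x, hx, rfl⟩
    obtain rfl : x.2.1.length = k := hx
    rw [barBasis_apply]
    exact hgr x.2.1 x.1
  · have : f ∘ₗ barD = D.d ∘ₗ f := bar_ext fun g l _ => hd l g
    exact LinearMap.congr_fun this x

/-- Vertices must go to base points, and `bar_cons` propagates the values from there. No comparison
of boundaries is needed. -/
theorem eq_of_barCone_isHom (hf : ∀ g, (barCone (R := R) g).IsHom (κ g) f)
    (hf' : ∀ g, (barCone (R := R) g).IsHom (κ g) f') : f = f' := by
  have key : ∀ (l : List G) (g : G), f (bar g l) = f' (bar g l) := by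
    intro l
    induction l with
    | nil => intro g; exact (hf g).map_pt.trans (hf' g).map_pt.symm
    | cons a l ih => intro g; rw [bar_cons, (hf g).map_h, (hf' g).map_h, ih]
  exact bar_ext fun g l _ => key l g

end Hom

/-! ## Functoriality in maps of sets -/

/-- The entries of the image of `g[a₁|…|aₖ]` under a map of sets. -/
def barSteps (f : G → H) : G → List G → List H
  | _, [] => []
  | g, a :: l => ((f g)⁻¹ * f (g * a)) :: barSteps f (g * a) l

/-- Degenerate elements stay degenerate, so the formula for `barMap` holds for all lists. The
converse fails when `f` is not injective. -/
theorem one_mem_barSteps (f : G → H) {l : List G} (h : 1 ∈ l) (g : G) : 1 ∈ barSteps f g l := by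
  induction l generalizing g with
  | nil => simp at h
  | cons a l ih =>
    rw [barSteps, List.mem_cons]
    rcases List.mem_cons.1 h with rfl | h
    · simp
    · exact Or.inr (ih h _)

/-- The map of bar resolutions that is induced by a map of sets. In homogeneous coordinates, it is
`(g₀, …, gₖ) ↦ (f g₀, …, f gₖ)`. -/
def barMap (f : G → H) : BarModule R G →ₗ[R] BarModule R H :=
  Finsupp.linearCombination R fun x => bar (f x.1) (barSteps f x.1 x.2.1)

theorem barMap_bar (f : G → H) (g : G) (l : List G) :
    barMap f (bar g l : BarModule R G) = bar (f g) (barSteps f g l) := by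
  by_cases h : (1 : G) ∈ l
  · rw [bar_eq_zero g h, bar_eq_zero _ (one_mem_barSteps f h g), map_zero]
  · simp [bar, h, barMap]

/-- In homogeneous coordinates the cone prepends the vertex `g`, and `f` is applied to each vertex
separately. -/
theorem barMap_isHom (f : G → H) (g : G) :
    (barCone (R := R) g).IsHom (barCone (f g)) (barMap f) where
  map_h := by
    have : barMap f ∘ₗ (barCone (R := R) g).h = (barCone (f g)).h ∘ₗ barMap f :=
      bar_ext fun a l _ => by
        rw [LinearMap.comp_apply, LinearMap.comp_apply, barCone_h_bar, barMap_bar, barMap_bar,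
          barCone_h_bar, barSteps, mul_inv_cancel_left]
    exact LinearMap.congr_fun this
  map_pt := barMap_bar f g []
  map_aug := by
    have : barAug ∘ₗ barMap f = (barAug : BarModule R G →ₗ[R] R) :=
      bar_ext fun a l _ => by
        rw [LinearMap.comp_apply, barMap_bar, barAug_bar_eq, barAug_bar_eq]
        cases l <;> simp [barSteps]
    exact LinearMap.congr_fun this

theorem barMap_isChainMap (f : G → H) :
    IsChainMap (barResolution R G) (barResolution R H) (barMap f) :=
  isChainMap_of_barCone_isHom (κ := fun g => barCone (f g)) (barMap_isHom f)

theorem barMap_comp (f : H → K) (f' : G → H) :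
    (barMap (f ∘ f') : BarModule R G →ₗ[R] _) = barMap f ∘ₗ barMap f' :=
  eq_of_barCone_isHom (D := barResolution R K) (κ := fun g => barCone (f (f' g)))
    (barMap_isHom (f ∘ f')) fun g => (barMap_isHom f (f' g)).comp (barMap_isHom f' g)

theorem barMap_barMap (f : H → K) (f' : G → H) (x : BarModule R G) :
    barMap f (barMap f' x) = barMap (f ∘ f') x := by
  rw [barMap_comp]; rfl

/-- Left translation does not change the quotients of consecutive vertices. Thus the group action is
a special case of functoriality, and equivariance becomes an identity between maps of sets. -/
theorem barMap_mul_left (a : G) : (barMap (a * ·) : BarModule R G →ₗ[R] _) = barAct a := by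
  have key (l : List G) : ∀ g, barSteps (a * ·) g l = l := by
    induction l with
    | nil => intro g; rfl
    | cons b l ih => intro g; rw [barSteps, ih]; simp [mul_assoc]
  exact bar_ext fun g l _ => by rw [barMap_bar, barAct_bar, key]

theorem barMap_eq_id {f : G → G} (hf : ∀ g, f g = g) (x : BarModule R G) : barMap f x = x := by
  have : f = ((1 : G) * ·) := funext fun g => by rw [hf, one_mul]
  rw [this, barMap_mul_left]; simp

/-! ## The coproduct -/

/-- A trivial entry of `l` lies in one of the two pieces of every cut, so the formula persists for
degenerate symbols. -/
theorem barCoprod_bar (g : G) (l : List G) :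
    barCoprod (bar g l : BarModule R G) = ∑ i ∈ Finset.range (l.length + 1),
      bar g (l.take i) ⊗ₜ[R] bar (g * (l.take i).prod) (l.drop i) := by
  by_cases h : (1 : G) ∈ l
  · rw [bar_eq_zero g h, map_zero]
    refine (Finset.sum_eq_zero fun i _ => ?_).symm
    rw [← List.take_append_drop i l, List.mem_append] at h
    rcases h with h | h
    · rw [bar_eq_zero g h, TensorProduct.zero_tmul]
    · rw [bar_eq_zero _ h, TensorProduct.tmul_zero]
  · simp [bar, h, barCoprod]

/-- Prepend a vertex and cut. A cut behind the first entry leaves a cone in the left factor, which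
is the summand `h ⊗ 1`; the cut at the start gives `g[] ⊗` (the whole cone), which is the summand
`pt ε ⊗ h`. -/
theorem barCoprod_isHom (g : G) :
    (barCone (R := R) g).IsHom ((barCone g).tensor (barCone g)) barCoprod where
  map_h := by
    have : barCoprod ∘ₗ (barCone (R := R) g).h =
        (barCone g).tensorH (barCone g) ∘ₗ barCoprod := by
      refine bar_ext (M := BarModule R G ⊗[R] BarModule R G) fun a l _ => ?_
      rw [LinearMap.comp_apply, LinearMap.comp_apply, barCone_h_bar, barCoprod_bar, barCoprod_bar,
        map_sum, List.length_cons, Finset.sum_range_succ']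
      refine Eq.trans ?_ (Finset.sum_congr rfl fun i _ =>
        (Contraction.tensorH_tmul (barCone g) (barCone g) _ _).symm)
      refine Eq.trans ?_ (Finset.sum_add_distrib (M := BarModule R G ⊗[R] BarModule R G)).symm
      congr 1
      · refine Finset.sum_congr rfl fun i _ => ?_
        rw [List.take_succ_cons, List.drop_succ_cons, List.prod_cons, barCone_h_bar, mul_assoc,
          mul_inv_cancel_left]
      -- The augmentation kills every left factor except the empty one, so of the terms `pt ε ⊗ h`
      -- only the cut at `0` survives.
      · rw [Finset.sum_eq_single_of_mem 0 (by simp)]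
        · simp only [List.take_zero, barAug_bar_eq, if_true, one_smul, List.prod_nil, mul_one,
            List.drop_zero]
          exact congrArg (fun z => (bar g [] : BarModule R G) ⊗ₜ[R] z) (barCone_h_bar g a l).symm
        · intro i hi hi0
          have : l.take i ≠ [] := by
            intro h
            rw [List.take_eq_nil_iff] at h
            rcases h with h | rfl
            · exact hi0 h
            · simp at hi; exact hi0 hi
          rw [barAug_bar_eq, if_neg this, zero_smul]
    exact LinearMap.congr_fun this
  map_pt := by
    change barCoprod (bar g []) = bar g [] ⊗ₜ bar g []
    simp [barCoprod_bar]
  map_aug := by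
    have : tensorAug (C := barResolution R G) (D := barResolution R G) barAug barAug ∘ₗ barCoprod =
        (barAug : BarModule R G →ₗ[R] R) := by
      refine bar_ext fun a l _ => ?_
      rw [LinearMap.comp_apply, barCoprod_bar, map_sum,
        Finset.sum_eq_single_of_mem 0 (by simp)]
      · rw [tensorAug_tmul]
        simp [barAug_bar_eq]
      · intro i hi hi0
        have : l.take i = [] → l.drop i ≠ [] := by
          intro h h'
          rw [List.take_eq_nil_iff] at h
          rcases h with h | rfl
          · exact hi0 h
          · simp at hi; exact hi0 hi
        rw [tensorAug_tmul, barAug_bar_eq, barAug_bar_eq]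
        by_cases h : l.take i = []
        · rw [if_neg (this h), mul_zero]
        · rw [if_neg h, zero_mul]
    exact LinearMap.congr_fun this

theorem barCoprod_isChainMap :
    IsChainMap (barResolution R G) ((barResolution R G).tensor (barResolution R G)) barCoprod :=
  isChainMap_of_barCone_isHom (κ := fun g => (barCone g).tensor (barCone g)) barCoprod_isHom

theorem barCoprod_barMap (f : G → H) :
    barCoprod ∘ₗ barMap f =
      TensorProduct.map (barMap f) (barMap f) ∘ₗ (barCoprod : BarModule R G →ₗ[R] _) :=
  eq_of_barCone_isHom (D := (barResolution R H).tensor (barResolution R H))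
    (κ := fun g => (barCone (f g)).tensor (barCone (f g)))
    (fun g => (barCoprod_isHom (f g)).comp (barMap_isHom f g))
    (fun g => ((barMap_isHom f g).map (barMap_isHom f g)).comp (barCoprod_isHom g))

/-- Both iterated coproducts commute with the cones on the threefold tensor product, and such a map
is unique. -/
theorem barCoprod_coassoc (x : BarModule R G) :
    TensorProduct.assoc R _ _ _ (TensorProduct.map barCoprod LinearMap.id (barCoprod x)) =
      TensorProduct.map LinearMap.id barCoprod (barCoprod x) := by
  have : (TensorProduct.assoc R (BarModule R G) (BarModule R G) (BarModule R G)).toLinearMap ∘ₗ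
      TensorProduct.map barCoprod LinearMap.id ∘ₗ barCoprod =
      TensorProduct.map LinearMap.id barCoprod ∘ₗ barCoprod :=
    eq_of_barCone_isHom
      (D := (barResolution R G).tensor ((barResolution R G).tensor (barResolution R G)))
      (κ := fun g => (barCone g).tensor ((barCone g).tensor (barCone g)))
      (fun g => (Contraction.IsHom.assoc _ _ _).comp <|
        ((barCoprod_isHom g).map (Contraction.IsHom.id _)).comp (barCoprod_isHom g))
      (fun g => ((Contraction.IsHom.id _).map (barCoprod_isHom g)).comp (barCoprod_isHom g))
  exact LinearMap.congr_fun this x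

end BarCone

/-! ## The cross product of bar resolutions -/

section BarCross

variable {R G H K G' H' : Type} [CommRing R] [Group G] [Group H] [Group K] [Group G'] [Group H']

open DGModule

/-- The cross product of bar resolutions: the equivariant chain map with
`g[a₁|…|aₚ] ⊗ h[b₁|…|b_q] ↦ (combination of elements (g, h)[…])` that preserves augmentations. -/
def barCross (R G H : Type) [CommRing R] [Group G] [Group H] :
    BarModule R G ⊗[R] BarModule R H →ₗ[R] BarModule R (G × H) :=
  carried (C := (barResolution R G).tensor (barResolution R H)) (D := barResolution R (G × H))
    ((barBasis R G).tensorProduct (barBasis R H)) (fun i => barDeg i.1 + barDeg i.2)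
    (tensorAug (C := barResolution R G) (D := barResolution R H) barAug barAug)
    (fun i => barCone (i.1.1, i.2.1))

theorem barBasis_tensor_generates : ((barResolution R G).tensor (barResolution R H)).Generates
    (fun i : (G × {l : List G // 1 ∉ l}) × (H × {l : List H // 1 ∉ l}) => barDeg i.1 + barDeg i.2)
    ((barBasis R G).tensorProduct (barBasis R H)) := by
  have h := barBasis_generates (R := R) (G := G).tensor (barBasis_generates (R := R) (G := H))
  have h' : (fun i : (G × {l : List G // 1 ∉ l}) × (H × {l : List H // 1 ∉ l}) =>
      barBasis R G i.1 ⊗ₜ[R] barBasis R H i.2) = (barBasis R G).tensorProduct (barBasis R H) :=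
    funext fun i => (Module.Basis.tensorProduct_apply' _ _ i).symm
  rwa [h'] at h

theorem tensorAug_bar_tensorD (z : BarModule R G ⊗[R] BarModule R H) :
    tensorAug (C := barResolution R G) (D := barResolution R H) barAug barAug
      (tensorD (barResolution R G) (barResolution R H) z) = 0 :=
  ((barCone 1).tensor (barCone 1)).aug_d z

theorem barCross_isChainMap : IsChainMap ((barResolution R G).tensor (barResolution R H))
    (barResolution R (G × H)) (barCross R G H) := by
  refine carried_chainMap _ barBasis_tensor_generates tensorAug_bar_tensorD fun i hi => ?_
  obtain ⟨k, hk⟩ := Nat.exists_eq_succ_of_ne_zero hi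
  refine ((barCone (R := R) (1 : G)).tensor (barCone (1 : H))).aug_gr k _ ?_
  have := barBasis_tensor_generates.mem (R := R) i
  rwa [hk] at this

theorem barAug_barCross (x : BarModule R G) (y : BarModule R H) :
    barAug (barCross R G H (x ⊗ₜ y)) = barAug x * barAug y := by
  have h := aug_carried (C := (barResolution R G).tensor (barResolution R H))
    (D := barResolution R (G × H))
    (ε := tensorAug (C := barResolution R G) (D := barResolution R H) barAug barAug)
    (fun i => barCone (i.1.1, i.2.1)) barBasis_tensor_generates (x ⊗ₜ y)
  rw [tensorAug_tmul] at h
  exact h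

/-- The cross product of elements over the vertices `g` and `h` is an element over `(g, h)`. -/
theorem barCone_h_barCross {g : G} {h : H} {x : BarModule R G} {y : BarModule R H}
    (hx : (barCone g).h x = 0) (hy : (barCone h).h y = 0) :
    (barCone (g, h)).h (barCross R G H (x ⊗ₜ y)) = 0 := by
  rw [barCone_h_eq_zero_iff] at hx hy
  induction hx using Submodule.span_induction with
  | mem x hx =>
    obtain ⟨l, rfl⟩ := hx
    induction hy using Submodule.span_induction with
    | mem y hy =>
      obtain ⟨m, rfl⟩ := hy
      dsimp only
      by_cases hl : 1 ∈ l
      · rw [bar_eq_zero g hl]; simp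
      by_cases hm : 1 ∈ m
      · rw [bar_eq_zero h hm]; simp
      have := h_carried_basis (C := (barResolution R G).tensor (barResolution R H))
        (D := barResolution R (G × H))
        (ε := tensorAug (C := barResolution R G) (D := barResolution R H) barAug barAug)
        (fun i => barCone (i.1.1, i.2.1)) barBasis_tensor_generates
        ((g, ⟨l, hl⟩), (h, ⟨m, hm⟩))
      rw [Module.Basis.tensorProduct_apply', barBasis_apply, barBasis_apply] at this
      exact this
    | zero => simp
    | add a b _ _ iha ihb => rw [TensorProduct.tmul_add, map_add, map_add, iha, ihb, add_zero]
    | smul r a _ iha => rw [TensorProduct.tmul_smul, map_smul, map_smul, iha, smul_zero]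
  | zero => simp
  | add a b _ _ iha ihb => rw [TensorProduct.add_tmul, map_add, map_add, iha, ihb, add_zero]
  | smul r a _ iha => rw [← TensorProduct.smul_tmul', map_smul, map_smul, iha, smul_zero]

/-! ### Naturality, associativity, symmetry and units of the cross product -/

theorem barCone_h_barMap {f : G → H} {g : G} {x : BarModule R G} (hx : (barCone g).h x = 0) :
    (barCone (f g)).h (barMap f x) = 0 := by
  rw [← (barMap_isHom f g).map_h, hx, map_zero]

theorem barAug_barMap (f : G → H) (x : BarModule R G) : barAug (barMap f x) = barAug x :=
  (barMap_isHom f 1).map_aug x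

/-- On a generator over `(g, h)` both sides are killed by the cone at `(f g, f' h)`. Neither map has
to be a homomorphism, which is essential for applying this to `blockMul`. -/
theorem barCross_barMap (f : G → G') (f' : H → H') (x : BarModule R G) (y : BarModule R H) :
    barCross R G' H' (barMap f x ⊗ₜ barMap f' y) =
      barMap (Prod.map f f') (barCross R G H (x ⊗ₜ y)) := by
  have : barCross R G' H' ∘ₗ TensorProduct.map (barMap f) (barMap f') =
      barMap (Prod.map f f') ∘ₗ barCross R G H := by
    refine (barBasis_generates.tensor barBasis_generates).chainMap_unique
      (C := (barResolution R G).tensor (barResolution R H)) (D := barResolution R (G' × H'))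
      (fun i => barCone (f i.1.1, f' i.2.1))
      (barCross_isChainMap.comp ((barMap_isChainMap f).map (barMap_isChainMap f')))
      ((barMap_isChainMap _).comp barCross_isChainMap) ?_ ?_ ?_
    · rintro ⟨i, j⟩
      rw [barBasis_apply, barBasis_apply, LinearMap.comp_apply, TensorProduct.map_tmul]
      exact barCone_h_barCross (barCone_h_barMap (barCone_h_bar_self _ _))
        (barCone_h_barMap (barCone_h_bar_self _ _))
    · rintro ⟨i, j⟩
      rw [barBasis_apply, barBasis_apply]
      exact barCone_h_barMap (f := Prod.map f f') (g := (i.1, j.1)) <|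
        barCone_h_barCross (barCone_h_bar_self _ _) (barCone_h_bar_self _ _)
    · rintro ⟨i, j⟩ -
      rw [LinearMap.comp_apply, LinearMap.comp_apply, TensorProduct.map_tmul, barAug_barCross,
        barAug_barMap, barAug_barMap, barAug_barMap, barAug_barCross]
  exact LinearMap.congr_fun this (x ⊗ₜ y)

/-- Both triple products are carried by the cones at `(g, h, k)`. The map induced by the
reassociation bijection only puts them into the same target. -/
theorem barCross_assoc (x : BarModule R G) (y : BarModule R H) (z : BarModule R K) :
    barMap (Equiv.prodAssoc G H K)
        (barCross R (G × H) K (barCross R G H (x ⊗ₜ y) ⊗ₜ z)) =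
      barCross R G (H × K) (x ⊗ₜ barCross R H K (y ⊗ₜ z)) := by
  have : barMap (Equiv.prodAssoc G H K) ∘ₗ barCross R (G × H) K ∘ₗ
        TensorProduct.map (barCross R G H) LinearMap.id ∘ₗ
        (TensorProduct.assoc R (BarModule R G) (BarModule R H) (BarModule R K)).symm.toLinearMap =
      barCross R G (H × K) ∘ₗ TensorProduct.map LinearMap.id (barCross R H K) := by
    refine (barBasis_generates.tensor
      (barBasis_generates.tensor barBasis_generates)).chainMap_unique
      (C := (barResolution R G).tensor ((barResolution R H).tensor (barResolution R K)))
      (D := barResolution R (G × H × K))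
      (fun i => barCone (i.1.1, i.2.1.1, i.2.2.1))
      ((barMap_isChainMap _).comp <| barCross_isChainMap.comp <|
        (barCross_isChainMap.map (IsChainMap.id _)).comp (IsChainMap.assoc_symm _ _ _))
      (barCross_isChainMap.comp ((IsChainMap.id _).map barCross_isChainMap)) ?_ ?_ ?_
    · rintro ⟨i, j, k⟩
      rw [barBasis_apply, barBasis_apply, barBasis_apply]
      exact barCone_h_barMap (f := Equiv.prodAssoc G H K) (g := ((i.1, j.1), k.1)) <|
        barCone_h_barCross (barCone_h_barCross (barCone_h_bar_self _ _) (barCone_h_bar_self _ _))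
          (barCone_h_bar_self _ _)
    · rintro ⟨i, j, k⟩
      rw [barBasis_apply, barBasis_apply, barBasis_apply]
      exact barCone_h_barCross (barCone_h_bar_self _ _)
        (barCone_h_barCross (barCone_h_bar_self _ _) (barCone_h_bar_self _ _))
    · rintro ⟨i, j, k⟩ -
      change barAug (barMap _ (barCross R _ _ (barCross R _ _ (_ ⊗ₜ _) ⊗ₜ _))) =
        barAug (barCross R _ _ (_ ⊗ₜ barCross R _ _ (_ ⊗ₜ _)))
      simp only [barAug_barCross, barAug_barMap, mul_assoc, LinearMap.id_apply]
  exact LinearMap.congr_fun this (x ⊗ₜ (y ⊗ₜ z))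

/-- Symmetry is needed in this three-factor form because the commutativity law of an operad compares
`a ∘ (b ∘ c)` with `b ∘ (a ∘ c)`. The sign is that of the chain map `leftSwap`; the cones carry both
sides. -/
theorem barCross_leftComm {p q : ℕ} {x : BarModule R G} {y : BarModule R H}
    (hx : x ∈ barGr p) (hy : y ∈ barGr q) (z : BarModule R K) :
    barCross R G (H × K) (x ⊗ₜ barCross R H K (y ⊗ₜ z)) =
      (-1 : R) ^ (p * q) • barMap (fun v : H × G × K => (v.2.1, v.1, v.2.2))
        (barCross R H (G × K) (y ⊗ₜ barCross R G K (x ⊗ₜ z))) := by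
  set φ : H × G × K → G × H × K := fun v => (v.2.1, v.1, v.2.2)
  have : barCross R G (H × K) ∘ₗ TensorProduct.map LinearMap.id (barCross R H K) =
      barMap φ ∘ₗ barCross R H (G × K) ∘ₗ TensorProduct.map LinearMap.id (barCross R G K) ∘ₗ
        leftSwap (barResolution R G) (barResolution R H) (barResolution R K) := by
    refine (barBasis_generates.tensor
      (barBasis_generates.tensor barBasis_generates)).chainMap_unique
      (C := (barResolution R G).tensor ((barResolution R H).tensor (barResolution R K)))
      (D := barResolution R (G × H × K))
      (fun i => barCone (i.1.1, i.2.1.1, i.2.2.1))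
      (barCross_isChainMap.comp ((IsChainMap.id _).map barCross_isChainMap))
      ((barMap_isChainMap _).comp <| barCross_isChainMap.comp <|
        ((IsChainMap.id _).map barCross_isChainMap).comp (IsChainMap.leftSwap _ _ _)) ?_ ?_ ?_
    · rintro ⟨i, j, k⟩
      rw [barBasis_apply, barBasis_apply, barBasis_apply]
      exact barCone_h_barCross (barCone_h_bar_self _ _)
        (barCone_h_barCross (barCone_h_bar_self _ _) (barCone_h_bar_self _ _))
    · rintro ⟨i, j, k⟩
      simp only [LinearMap.comp_apply]
      rw [leftSwap_tmul _ _ _ (barBasis_generates.mem i) (barBasis_generates.mem j), map_smul,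
        map_smul, map_smul, map_smul]
      rw [barBasis_apply, barBasis_apply, barBasis_apply]
      -- The sign only scales an element that the cone kills.
      refine (congrArg _ ?_).trans (smul_zero _)
      exact barCone_h_barMap (f := φ) (g := (j.1, i.1, k.1)) <|
        barCone_h_barCross (barCone_h_bar_self _ _)
          (barCone_h_barCross (barCone_h_bar_self _ _) (barCone_h_bar_self _ _))
    · rintro ⟨i, j, k⟩ h0
      simp only [LinearMap.comp_apply]
      have h1 : barDeg i = 0 := by simp only at h0; omega
      rw [leftSwap_tmul _ _ _ (barBasis_generates.mem i) (barBasis_generates.mem j), h1,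
        zero_mul, pow_zero, one_smul]
      change barAug (barCross R _ _ (_ ⊗ₜ barCross R _ _ (_ ⊗ₜ _))) =
        barAug (barMap _ (barCross R _ _ (_ ⊗ₜ barCross R _ _ (_ ⊗ₜ _))))
      simp only [barAug_barCross, barAug_barMap, LinearMap.id_apply]
      rw [mul_left_comm]
  have h := LinearMap.congr_fun this (x ⊗ₜ (y ⊗ₜ z))
  simp only [LinearMap.comp_apply] at h
  rw [leftSwap_tmul (barResolution R G) (barResolution R H) (barResolution R K) hx hy, map_smul,
    map_smul, map_smul] at h
  exact h

/-- Multiplication by a vertex is a chain map, so the left side is a chain map in `y` that keeps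
elements over `h` over `h`, as the identity does. Only the values of `f` on the slice `{g} × H`
matter. -/
theorem barCross_vertex_left (g : G) {f : G × H → H} (hf : ∀ h, f (g, h) = h)
    (y : BarModule R H) : barMap f (barCross R G H (bar g [] ⊗ₜ y)) = y := by
  have hg : (bar g [] : BarModule R G) ∈ (barResolution R G).gr 0 :=
    bar_mem_barGr g [] fun _ => rfl
  have hchain : IsChainMap (barResolution R H) ((barResolution R G).tensor (barResolution R H))
      (TensorProduct.mk R (BarModule R G) (BarModule R H) (bar g [])) := by
    refine ⟨fun k x hx => tmul_mem _ _ (zero_add k) hg hx, fun x => ?_⟩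
    have := tensorD_tmul (barResolution R G) (barResolution R H) hg x
    rw [(barResolution R G).d_zero _ hg, TensorProduct.zero_tmul, zero_add, pow_zero,
      one_smul] at this
    exact this.symm
  have : barMap f ∘ₗ barCross R G H ∘ₗ TensorProduct.mk R _ _ (bar g []) = LinearMap.id := by
    refine barBasis_generates.chainMap_unique (C := barResolution R H) (D := barResolution R H)
      (fun i => barCone i.1)
      ((barMap_isChainMap _).comp <| barCross_isChainMap.comp hchain) (IsChainMap.id _) ?_ ?_ ?_
    · intro i
      have := barCone_h_barMap (f := f) <| barCone_h_barCross
        (barCone_h_bar_self (R := R) g []) (barCone_h_bar_self (R := R) i.1 i.2.1)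
      rw [hf] at this
      rw [barBasis_apply]
      exact this
    · intro i
      rw [barBasis_apply]
      exact barCone_h_bar_self _ _
    · intro i _
      change barAug (barMap _ (barCross R _ _ (_ ⊗ₜ _))) = _
      rw [barAug_barMap, barAug_barCross, barAug_bar_eq, if_pos rfl, one_mul]
      rfl
  exact LinearMap.congr_fun this y

theorem barCross_vertex_right (h : H) {f : G × H → G} (hf : ∀ g, f (g, h) = g)
    (x : BarModule R G) : barMap f (barCross R G H (x ⊗ₜ bar h [])) = x := by
  have hh : (bar h [] : BarModule R H) ∈ (barResolution R H).gr 0 :=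
    bar_mem_barGr h [] fun _ => rfl
  have hchain : IsChainMap (barResolution R G) ((barResolution R G).tensor (barResolution R H))
      ((TensorProduct.mk R (BarModule R G) (BarModule R H)).flip (bar h [])) := by
    refine ⟨fun k x hx => tmul_mem _ _ (add_zero k) hx hh, fun x => ?_⟩
    change _ = tensorD (barResolution R G) (barResolution R H) (x ⊗ₜ bar h [])
    simp only [tensorD, LinearMap.add_apply, TensorProduct.map_tmul, LinearMap.id_apply]
    rw [(barResolution R H).d_zero _ hh, TensorProduct.tmul_zero, add_zero]
    rfl
  have : barMap f ∘ₗ barCross R G H ∘ₗ (TensorProduct.mk R _ _).flip (bar h []) =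
      LinearMap.id := by
    refine barBasis_generates.chainMap_unique (C := barResolution R G) (D := barResolution R G)
      (fun i => barCone i.1)
      ((barMap_isChainMap _).comp <| barCross_isChainMap.comp hchain) (IsChainMap.id _) ?_ ?_ ?_
    · intro i
      have := barCone_h_barMap (f := f) <| barCone_h_barCross
        (barCone_h_bar_self (R := R) i.1 i.2.1) (barCone_h_bar_self (R := R) h [])
      rw [hf] at this
      rw [barBasis_apply]
      exact this
    · intro i
      rw [barBasis_apply]
      exact barCone_h_bar_self _ _
    · intro i _
      change barAug (barMap _ (barCross R _ _ (_ ⊗ₜ _))) = _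
      rw [barAug_barMap, barAug_barCross, barAug_bar_eq, if_pos rfl, mul_one]
      rfl
  exact LinearMap.congr_fun this x

/-- The two alternatives are the two ways in which the summand `pt ε ⊗ h` can vanish. They separate
cuts with nonempty left part from the trivial cut in `barCoprod_barCross`. -/
theorem barCone_tensor_h_tmul {g : G} {x y : BarModule R G} (hx : (barCone g).h x = 0)
    (hy : barAug x = 0 ∨ (barCone g).h y = 0) :
    ((barCone g).tensor (barCone g)).h (x ⊗ₜ y) = 0 := by
  rw [Contraction.tensor_h_tmul, hx, TensorProduct.zero_tmul, zero_add]
  rcases hy with h | h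
  · rw [h, zero_smul]
  · rw [h, TensorProduct.tmul_zero, smul_zero]

/-- The coproduct is multiplicative with respect to the cross product. -/
theorem barCoprod_barCross (z : BarModule R G ⊗[R] BarModule R H) :
    barCoprod (barCross R G H z) =
      TensorProduct.map (barCross R G H) (barCross R G H)
        (interchange (barResolution R G) (barResolution R G) (barResolution R H)
          (barResolution R H) (TensorProduct.map barCoprod barCoprod z)) := by
  have : barCoprod ∘ₗ barCross R G H =
      TensorProduct.map (barCross R G H) (barCross R G H) ∘ₗ
        interchange (barResolution R G) (barResolution R G) (barResolution R H)
          (barResolution R H) ∘ₗ TensorProduct.map barCoprod barCoprod := by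
    refine (barBasis_generates.tensor barBasis_generates).chainMap_unique
      (C := (barResolution R G).tensor (barResolution R H))
      (D := (barResolution R (G × H)).tensor (barResolution R (G × H)))
      (fun i => (barCone (i.1.1, i.2.1)).tensor (barCone (i.1.1, i.2.1)))
      (barCoprod_isChainMap.comp barCross_isChainMap)
      ((barCross_isChainMap.map barCross_isChainMap).comp <|
        (IsChainMap.interchange _ _ _ _).comp (barCoprod_isChainMap.map barCoprod_isChainMap))
      ?_ ?_ ?_
    · rintro ⟨i, j⟩
      rw [barBasis_apply, barBasis_apply, LinearMap.comp_apply,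
        ← (barCoprod_isHom (i.1, j.1)).map_h,
        barCone_h_barCross (barCone_h_bar_self _ _) (barCone_h_bar_self _ _), map_zero]
    · rintro ⟨⟨g, l, hl⟩, ⟨h, m, hm⟩⟩
      rw [barBasis_apply, barBasis_apply]
      simp only [LinearMap.comp_apply, TensorProduct.map_tmul]
      rw [barCoprod_bar, barCoprod_bar, TensorProduct.sum_tmul, map_sum, map_sum, map_sum]
      refine Finset.sum_eq_zero fun i hi => ?_
      rw [TensorProduct.tmul_sum, map_sum, map_sum, map_sum]
      refine Finset.sum_eq_zero fun j hj => ?_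
      rw [interchange_tmul (barResolution R G) (barResolution R G) (barResolution R H)
          (barResolution R H) _ _ (bar_mem_barGr _ _ fun _ => rfl)
          (bar_mem_barGr _ _ fun _ => rfl), map_smul, map_smul, TensorProduct.map_tmul]
      refine (congrArg _ ?_).trans (smul_zero _)
      refine barCone_tensor_h_tmul
        (barCone_h_barCross (barCone_h_bar_self _ _) (barCone_h_bar_self _ _)) ?_
      rw [barAug_barCross, barAug_bar_eq, barAug_bar_eq]
      -- If one left piece is nonempty, the left factor has positive dimension and augmentation
      -- zero. If both are empty, the right factor is the uncut cross product, still over the vertex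
      -- `(g, h)`.
      by_cases hi' : l.take i = []
      · by_cases hj' : m.take j = []
        · right
          have h1 : l.drop i = l := by simpa [hi'] using List.take_append_drop i l
          have h2 : m.drop j = m := by simpa [hj'] using List.take_append_drop j m
          rw [hi', hj', h1, h2, List.prod_nil, List.prod_nil, mul_one, mul_one]
          exact barCone_h_barCross (barCone_h_bar_self _ _) (barCone_h_bar_self _ _)
        · left; rw [if_neg hj', mul_zero]
      · left; rw [if_neg hi', zero_mul]
    · rintro ⟨⟨g, l, hl⟩, ⟨h, m, hm⟩⟩ h0
      obtain ⟨h1, h2⟩ : l.length = 0 ∧ m.length = 0 := Nat.add_eq_zero_iff.1 h0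
      obtain rfl := List.length_eq_zero_iff.1 h1
      obtain rfl := List.length_eq_zero_iff.1 h2
      rw [barBasis_apply, barBasis_apply]
      simp only [LinearMap.comp_apply, TensorProduct.map_tmul]
      rw [(barCoprod_isHom 1).map_aug, barAug_barCross, barCoprod_bar, barCoprod_bar]
      simp only [List.length_nil, zero_add, Finset.range_one, Finset.sum_singleton, List.take_zero,
        List.prod_nil, mul_one, List.drop_zero]
      rw [interchange_tmul (barResolution R G) (barResolution R G) (barResolution R H)
          (barResolution R H) _ _ (bar_mem_barGr _ _ fun _ => rfl)
          (bar_mem_barGr _ _ fun _ => rfl), map_smul, map_smul, TensorProduct.map_tmul,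
        tensorAug_tmul, barAug_barCross]
      simp [barAug_bar_eq]
  exact LinearMap.congr_fun this z

end BarCross

/-! ## The operad of symmetric groups -/

section BlockMul

variable {n m t nm nt mt N : ℕ}

/-- The `x`-th position in the block that replaces the position `i`. -/
def innerPos (h : N + 1 = n + m) (i : Fin m) (x : Fin n) : Fin N := blockPos h i (Sum.inl x)

/-- The position that comes from `k ≠ i` when `i` is replaced by a block. -/
def outerPos (h : N + 1 = n + m) (i k : Fin m) (hk : k ≠ i) : Fin N := blockPos h i (Sum.inr ⟨k, hk⟩)

theorem innerPos_val (h : N + 1 = n + m) (i : Fin m) (x : Fin n) :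
    (innerPos h i x : ℕ) = i + x := rfl

theorem outerPos_val (h : N + 1 = n + m) (i k : Fin m) (hk : k ≠ i) :
    (outerPos h i k hk : ℕ) = if (k : ℕ) < i then (k : ℕ) else n + k - 1 := by
  unfold outerPos blockPos
  simp only [Fin.lt_def]
  split_ifs <;> rfl

theorem pos_cases (h : N + 1 = n + m) (i : Fin m) (z : Fin N) :
    (∃ x, innerPos h i x = z) ∨ ∃ k hk, outerPos h i k hk = z := by
  obtain ⟨x | ⟨k, hk⟩, rfl⟩ := (blockPos_bijective h i).2 z
  · exact Or.inl ⟨x, rfl⟩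
  · exact Or.inr ⟨k, hk, rfl⟩

theorem outerPos_ne_innerPos (h : N + 1 = n + m) (i k : Fin m) (hk : k ≠ i) (x : Fin n) :
    outerPos h i k hk ≠ innerPos h i x := fun e => by
  simpa using (blockPos_bijective h i).1 e

theorem outerPos_injective (h : N + 1 = n + m) (i k k' : Fin m) (hk : k ≠ i) (hk' : k' ≠ i)
    (e : outerPos h i k hk = outerPos h i k' hk') : k = k' := by
  simpa using (blockPos_bijective h i).1 e

theorem innerPos_injective (h : N + 1 = n + m) (i : Fin m) : Function.Injective (innerPos h i) :=
  fun x y e => by simpa using (blockPos_bijective h i).1 e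

theorem blockEquiv_symm_innerPos (h : N + 1 = n + m) (i : Fin m) (x : Fin n) :
    (blockEquiv h i).symm (innerPos h i x) = Sum.inl x :=
  (blockEquiv h i).symm_apply_apply (Sum.inl x)

theorem blockEquiv_symm_outerPos (h : N + 1 = n + m) (i k : Fin m) (hk : k ≠ i) :
    (blockEquiv h i).symm (outerPos h i k hk) = Sum.inr ⟨k, hk⟩ :=
  (blockEquiv h i).symm_apply_apply (Sum.inr ⟨k, hk⟩)

theorem blockSum_innerPos (h : N + 1 = n + m) (i : Fin m) (τ : Equiv.Perm (Fin n)) (x : Fin n) :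
    blockSum h i τ (innerPos h i x) = innerPos h i (τ x) := by
  simp only [blockSum, Equiv.trans_apply, blockEquiv_symm_innerPos]
  rfl

theorem blockSum_outerPos (h : N + 1 = n + m) (i : Fin m) (τ : Equiv.Perm (Fin n)) (k : Fin m)
    (hk : k ≠ i) : blockSum h i τ (outerPos h i k hk) = outerPos h i k hk := by
  simp only [blockSum, Equiv.trans_apply, blockEquiv_symm_outerPos]
  rfl

theorem blockPerm_innerPos (h : N + 1 = n + m) (i : Fin m) (σ : Equiv.Perm (Fin m)) (x : Fin n) :
    blockPerm h i σ (innerPos h i x) = innerPos h (σ i) x := by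
  simp only [blockPerm, Equiv.trans_apply, blockEquiv_symm_innerPos]
  rfl

theorem blockPerm_outerPos (h : N + 1 = n + m) (i : Fin m) (σ : Equiv.Perm (Fin m)) (k : Fin m)
    (hk : k ≠ i) : blockPerm h i σ (outerPos h i k hk) =
      outerPos h (σ i) (σ k) (σ.injective.ne hk) := by
  simp only [blockPerm, Equiv.trans_apply, blockEquiv_symm_outerPos]
  rfl

/-- The composition of permutations: `σ` permutes `m` blocks, and then `τ` permutes the `i`-th block,
which has length `n`. -/
def blockMul (h : N + 1 = n + m) (i : Fin m) (v : Equiv.Perm (Fin n) × Equiv.Perm (Fin m)) :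
    Equiv.Perm (Fin N) :=
  blockSum h i v.1 * blockPerm h (v.2⁻¹ i) v.2

/-- The index before the permutation is a variable `i'` with `σ i' = i`, which avoids rewriting `σ
(σ⁻¹ i)` inside dependent positions. -/
theorem blockMul_innerPos (h : N + 1 = n + m) (τ : Equiv.Perm (Fin n)) {σ : Equiv.Perm (Fin m)}
    {i i' : Fin m} (hi : σ i' = i) (x : Fin n) :
    blockMul h i (τ, σ) (innerPos h i' x) = innerPos h i (τ x) := by
  subst hi
  simp [blockMul, blockPerm_innerPos, blockSum_innerPos]

theorem blockMul_outerPos (h : N + 1 = n + m) (τ : Equiv.Perm (Fin n)) {σ : Equiv.Perm (Fin m)}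
    {i i' : Fin m} (hi : σ i' = i) {k k' : Fin m} (hk : σ k' = k) (hne : k' ≠ i') :
    blockMul h i (τ, σ) (outerPos h i' k' hne) =
      outerPos h i k (fun e => hne (σ.injective ((hk.trans e).trans hi.symm))) := by
  subst hi hk
  simp [blockMul, blockPerm_outerPos, blockSum_outerPos]

theorem blockMul_one (h : N + 1 = n + m) (i : Fin m) : blockMul h i (1, 1) = 1 := by
  ext z : 1
  rcases pos_cases h i z with ⟨x, rfl⟩ | ⟨k, hk, rfl⟩
  · exact blockMul_innerPos h 1 rfl x
  · exact blockMul_outerPos h 1 rfl rfl hk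

/-- Together with `blockMul_mul_left` this is the equivariance of the compositions on the level of
vertices. -/
theorem blockMul_mul_right (h : N + 1 = n + m) (i : Fin m) (τ : Equiv.Perm (Fin n))
    (σ ρ : Equiv.Perm (Fin m)) :
    blockMul h (σ i) (τ, σ * ρ) = blockPerm h i σ * blockMul h i (τ, ρ) := by
  obtain ⟨i', hi⟩ := ρ.surjective i
  have hi' : (σ * ρ) i' = σ i := congrArg σ hi
  ext z : 1
  rw [Equiv.Perm.mul_apply]
  rcases pos_cases h i' z with ⟨x, rfl⟩ | ⟨k, hk, rfl⟩
  · rw [blockMul_innerPos h τ hi', blockMul_innerPos h τ hi, blockPerm_innerPos]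
  · rw [blockMul_outerPos h τ hi' rfl, blockMul_outerPos h τ hi rfl, blockPerm_outerPos]; rfl

theorem blockSum_mul (h : N + 1 = n + m) (i : Fin m) (τ τ' : Equiv.Perm (Fin n)) :
    blockSum h i (τ * τ') = blockSum h i τ * blockSum h i τ' := by
  ext z : 1
  rcases pos_cases h i z with ⟨x, rfl⟩ | ⟨k, hk, rfl⟩
  · simp [blockSum_innerPos]
  · simp [blockSum_outerPos]

theorem blockMul_mul_left (h : N + 1 = n + m) (i : Fin m) (τ τ' : Equiv.Perm (Fin n))
    (σ : Equiv.Perm (Fin m)) :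
    blockMul h i (τ * τ', σ) = blockSum h i τ * blockMul h i (τ', σ) := by
  rw [blockMul, blockSum_mul, mul_assoc]; rfl

/-! ### Positions under iterated substitution, and the operad laws for permutations -/

theorem innerPos_innerPos (h₁ : nm + 1 = n + m) (h₂ : N + 1 = nm + t) (h₃ : mt + 1 = m + t)
    (h₄ : N + 1 = n + mt) (i : Fin m) (j : Fin t) (x : Fin n) :
    innerPos h₂ j (innerPos h₁ i x) = innerPos h₄ (innerPos h₃ j i) x := by
  ext
  simp only [innerPos_val]
  omega

theorem innerPos_outerPos (h₁ : nm + 1 = n + m) (h₂ : N + 1 = nm + t) (h₃ : mt + 1 = m + t)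
    (h₄ : N + 1 = n + mt) (i k : Fin m) (j : Fin t) (hk : k ≠ i) :
    innerPos h₂ j (outerPos h₁ i k hk) =
      outerPos h₄ (innerPos h₃ j i) (innerPos h₃ j k) ((innerPos_injective h₃ j).ne hk) := by
  have := Fin.val_ne_of_ne hk
  ext
  simp only [innerPos_val, outerPos_val, add_lt_add_iff_left]
  split_ifs <;> omega

theorem outerPos_outerPos (h₁ : nm + 1 = n + m) (h₂ : N + 1 = nm + t) (h₃ : mt + 1 = m + t)
    (h₄ : N + 1 = n + mt) (i : Fin m) (j k : Fin t) (hk : k ≠ j) :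
    outerPos h₂ j k hk =
      outerPos h₄ (innerPos h₃ j i) (outerPos h₃ j k hk) (outerPos_ne_innerPos h₃ j k hk i) := by
  have := Fin.val_ne_of_ne hk
  ext
  simp only [innerPos_val, outerPos_val]
  split_ifs <;> omega

/-- A position lies in the innermost block, in the middle block outside the innermost one, or
outside both. In each case the two descriptions of the position agree before and after the
permutation, and both sides move it alike. -/
theorem blockMul_assoc (h₁ : nm + 1 = n + m) (h₂ : N + 1 = nm + t) (h₃ : mt + 1 = m + t)
    (h₄ : N + 1 = n + mt) (i : Fin m) (j : Fin t) (τ : Equiv.Perm (Fin n))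
    (σ : Equiv.Perm (Fin m)) (ρ : Equiv.Perm (Fin t)) :
    blockMul h₂ j (blockMul h₁ i (τ, σ), ρ) =
      blockMul h₄ (innerPos h₃ j i) (τ, blockMul h₃ j (σ, ρ)) := by
  obtain ⟨i', hi⟩ := σ.surjective i
  obtain ⟨j', hj⟩ := ρ.surjective j
  have hij : blockMul h₃ j (σ, ρ) (innerPos h₃ j' i') = innerPos h₃ j i := by
    rw [blockMul_innerPos h₃ σ hj, hi]
  ext z : 1
  rcases pos_cases h₂ j' z with ⟨z, rfl⟩ | ⟨k, hk, rfl⟩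
  · rw [blockMul_innerPos h₂ _ hj]
    rcases pos_cases h₁ i' z with ⟨x, rfl⟩ | ⟨k, hk, rfl⟩
    · rw [blockMul_innerPos h₁ τ hi, innerPos_innerPos h₁ h₂ h₃ h₄, innerPos_innerPos h₁ h₂ h₃ h₄,
        blockMul_innerPos h₄ τ hij]
    · rw [blockMul_outerPos h₁ τ hi rfl, innerPos_outerPos h₁ h₂ h₃ h₄,
        innerPos_outerPos h₁ h₂ h₃ h₄,
        blockMul_outerPos h₄ τ hij (blockMul_innerPos h₃ σ hj k)]
  · rw [blockMul_outerPos h₂ _ hj rfl, outerPos_outerPos h₁ h₂ h₃ h₄ i,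
      outerPos_outerPos h₁ h₂ h₃ h₄ i', blockMul_outerPos h₄ τ hij (blockMul_outerPos h₃ σ hj rfl hk)]

/-- Only `i ≠ j` is assumed, not an order, so the same identity serves with the two blocks
exchanged. -/
theorem innerPos_outerPos_comm (h₁ : mt + 1 = m + t) (h₂ : N + 1 = n + mt) (h₃ : nt + 1 = n + t)
    (h₄ : N + 1 = m + nt) (i j : Fin t) (hij : i ≠ j) (x : Fin n) :
    innerPos h₂ (outerPos h₁ j i hij) x =
      outerPos h₄ (outerPos h₃ i j hij.symm) (innerPos h₃ i x)
        (outerPos_ne_innerPos h₃ i j hij.symm x).symm := by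
  have := Fin.val_ne_of_ne hij
  ext
  simp only [innerPos_val, outerPos_val]
  split_ifs <;> omega

theorem outerPos_outerPos_comm (h₁ : mt + 1 = m + t) (h₂ : N + 1 = n + mt) (h₃ : nt + 1 = n + t)
    (h₄ : N + 1 = m + nt) (i j k : Fin t) (hij : i ≠ j) (hi : k ≠ i) (hj : k ≠ j) :
    outerPos h₂ (outerPos h₁ j i hij) (outerPos h₁ j k hj)
        (fun e => hi (outerPos_injective _ _ _ _ _ _ e)) =
      outerPos h₄ (outerPos h₃ i j hij.symm) (outerPos h₃ i k hi)
        (fun e => hj (outerPos_injective _ _ _ _ _ _ e)) := by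
  have := Fin.val_ne_of_ne hij
  have := Fin.val_ne_of_ne hi
  have := Fin.val_ne_of_ne hj
  ext
  simp only [outerPos_val]
  split_ifs <;> omega

theorem blockMul_comm (h₁ : mt + 1 = m + t) (h₂ : N + 1 = n + mt) (h₃ : nt + 1 = n + t)
    (h₄ : N + 1 = m + nt) (i j : Fin t) (hij : i ≠ j) (τ : Equiv.Perm (Fin n))
    (σ : Equiv.Perm (Fin m)) (ρ : Equiv.Perm (Fin t)) :
    blockMul h₂ (outerPos h₁ j i hij) (τ, blockMul h₁ j (σ, ρ)) =
      blockMul h₄ (outerPos h₃ i j hij.symm) (σ, blockMul h₃ i (τ, ρ)) := by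
  obtain ⟨i', hi⟩ := ρ.surjective i
  obtain ⟨j', hj⟩ := ρ.surjective j
  have hij' : i' ≠ j' := fun e => hij (by rw [← hi, ← hj, e])
  have e₁ := blockMul_outerPos h₁ σ hj hi hij'
  have e₃ := blockMul_outerPos h₃ τ hi hj hij'.symm
  ext z : 1
  rcases pos_cases h₂ (outerPos h₁ j' i' hij') z with ⟨x, rfl⟩ | ⟨z, hz, rfl⟩
  · rw [blockMul_innerPos h₂ τ e₁, innerPos_outerPos_comm h₁ h₂ h₃ h₄,
      innerPos_outerPos_comm h₁ h₂ h₃ h₄,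
      blockMul_outerPos h₄ σ e₃ (blockMul_innerPos h₃ τ hi x)]
  · rcases pos_cases h₁ j' z with ⟨y, rfl⟩ | ⟨k, hk, rfl⟩
    · rw [blockMul_outerPos h₂ τ e₁ (blockMul_innerPos h₁ σ hj y),
        -- Here the roles of the two blocks are exchanged and the identity is read backwards.
        ← innerPos_outerPos_comm h₃ h₄ h₁ h₂ j' i' hij'.symm y,
        ← innerPos_outerPos_comm h₃ h₄ h₁ h₂ j i hij.symm, blockMul_innerPos h₄ σ e₃]
    · have hki : k ≠ i' := by rintro rfl; exact hz rfl
      rw [blockMul_outerPos h₂ τ e₁ (blockMul_outerPos h₁ σ hj rfl hk),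
        outerPos_outerPos_comm h₁ h₂ h₃ h₄ i' j' k hij' hki hk,
        blockMul_outerPos h₄ σ e₃ (blockMul_outerPos h₃ τ hi rfl hki)]
      exact outerPos_outerPos_comm h₁ h₂ h₃ h₄ i j (ρ k) hij
        (fun e => hki (ρ.injective (e.trans hi.symm))) (fun e => hk (ρ.injective (e.trans hj.symm)))

/-- The rank is a variable with `n = 1` so that the lemma applies to the coercion of `(1 : ℕ+)`. A
block of length one leaves all positions in place. -/
theorem blockMul_one_left (hn : n = 1) (h : m + 1 = n + m) (i : Fin m) (σ : Equiv.Perm (Fin m)) :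
    blockMul h i (1, σ) = σ := by
  have h1 (i : Fin m) (x : Fin n) : innerPos h i x = i := by
    ext; simp only [innerPos_val]; omega
  have h2 (i k : Fin m) (hk : k ≠ i) : outerPos h i k hk = k := by
    ext; simp only [outerPos_val]; split_ifs <;> omega
  obtain ⟨i', hi⟩ := σ.surjective i
  ext z : 1
  rcases pos_cases h i' z with ⟨x, rfl⟩ | ⟨k, hk, rfl⟩
  · rw [blockMul_innerPos h 1 hi, h1, h1, hi]
  · rw [blockMul_outerPos h 1 hi rfl, h2, h2]

theorem blockMul_one_right (hm : m = 1) (h : n + 1 = n + m) (i : Fin m) (τ : Equiv.Perm (Fin n)) :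
    blockMul h i (τ, 1) = τ := by
  have h1 (i : Fin m) (x : Fin n) : innerPos h i x = x := by
    ext; simp only [innerPos_val]; omega
  ext z : 1
  rcases pos_cases h i z with ⟨x, rfl⟩ | ⟨k, hk, rfl⟩
  · exact (blockMul_innerPos h τ (σ := 1) (i := i) (i' := i) rfl x).trans (by rw [h1, h1])
  · exact absurd (Fin.ext (by omega)) hk

end BlockMul

/-! ## The bar resolution is a free resolution -/

section BarFree

variable {R G : Type} [CommRing R] [Group G]

open DGModule

/-- The elements `1[a₁|…|aₖ]` of dimension `k`, in the module over the group algebra. -/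
def barVertexOne (R : Type) {G : Type} [CommRing R] [Group G] (k : ℕ)
    (l : {l : List G // 1 ∉ l ∧ l.length = k}) :
    (barAct : Representation R G (BarModule R G)).asModule :=
  (Representation.asModuleEquiv barAct).symm (bar 1 l.1)

theorem single_smul_barVertexOne (k : ℕ) (g : G) (r : R)
    (l : {l : List G // 1 ∉ l ∧ l.length = k}) :
    Representation.asModuleEquiv barAct (MonoidAlgebra.single g r • barVertexOne R k l) =
      Finsupp.single (g, ⟨l.1, l.2.1⟩) r := by
  rw [Representation.asModuleEquiv_map_smul, Representation.asAlgebraHom_single, barVertexOne,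
    LinearEquiv.apply_symm_apply, LinearMap.smul_apply, barAct_bar, mul_one]
  simp [bar, l.2.1]

/-- The coefficients can be recovered: the coefficient of `g` in the `l`-th scalar is the value of
the linear combination at the basis element `g[l]`. -/
theorem barVertexOne_linearIndependent (k : ℕ) :
    LinearIndependent (MonoidAlgebra R G) (barVertexOne R (G := G) k) := by
  have key : ∀ (c : {l : List G // 1 ∉ l ∧ l.length = k} →₀ MonoidAlgebra R G) (g : G)
      (l : {l : List G // 1 ∉ l ∧ l.length = k}),
      (Representation.asModuleEquiv barAct
        (Finsupp.linearCombination (MonoidAlgebra R G) (barVertexOne R (G := G) k) c) :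
          BarModule R G) (g, ⟨l.1, l.2.1⟩) = (c l).coeff g := by
    classical
    intro c g l
    induction c using Finsupp.induction_linear with
    | zero => simp
    | add a b ha hb =>
      rw [map_add, map_add, Finsupp.add_apply, ha, hb, Finsupp.add_apply, MonoidAlgebra.coeff_add,
        Finsupp.add_apply]
    | single l' a =>
      rw [Finsupp.linearCombination_single]
      induction a using MonoidAlgebra.induction_linear with
      | zero => simp
      | add a b ha hb =>
        rw [add_smul, map_add, Finsupp.add_apply, ha, hb, Finsupp.single_add, Finsupp.add_apply,
          MonoidAlgebra.coeff_add, Finsupp.add_apply]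
      | single g' r =>
        rw [single_smul_barVertexOne, Finsupp.single_apply, Finsupp.single_apply]
        by_cases hl : l' = l
        · subst hl
          simp [Finsupp.single_apply]
        · have hl' : l'.1 ≠ l.1 := fun e => hl (Subtype.ext e)
          simp [hl, hl']
  intro c c' hc
  ext l g
  rw [← key, ← key, hc]

/-- This identifies the dimension `k` part with an `R[G]`-span, so that it inherits the basis
`1[…]`; the converse direction uses `r g • 1[l] = r • g[l]`. -/
theorem mem_span_barVertexOne (k : ℕ)
    (x : (barAct : Representation R G (BarModule R G)).asModule) :
    x ∈ Submodule.span (MonoidAlgebra R G) (Set.range (barVertexOne R (G := G) k)) ↔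
      Representation.asModuleEquiv barAct x ∈ barGr (R := R) (G := G) k := by
  constructor
  · intro hx
    induction hx using Submodule.span_induction with
    | mem x hx =>
      obtain ⟨l, rfl⟩ := hx
      rw [barVertexOne, LinearEquiv.apply_symm_apply]
      exact bar_mem_barGr _ _ fun _ => l.2.2
    | zero => simp
    | add a b _ _ iha ihb => rw [map_add]; exact add_mem iha ihb
    | smul r a _ iha =>
      rw [Representation.asModuleEquiv_map_smul]
      induction r using MonoidAlgebra.induction_linear with
      | zero => simp
      | add r s hr hs => rw [map_add, LinearMap.add_apply]; exact add_mem hr hs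
      | single g r =>
        rw [Representation.asAlgebraHom_single, LinearMap.smul_apply]
        exact Submodule.smul_mem _ _ (barAct_mem _ _ _ iha)
  · intro hx
    have key : ∀ y ∈ barGr (R := R) (G := G) k,
        (Representation.asModuleEquiv barAct).symm y ∈
          Submodule.span (MonoidAlgebra R G) (Set.range (barVertexOne R (G := G) k)) := by
      intro y hy
      rw [← Finsupp.sum_single y, Finsupp.sum, map_sum]
      refine Submodule.sum_mem _ fun z hz => ?_
      have h := single_smul_barVertexOne k z.1 (y z) ⟨z.2.1, z.2.2, hy hz⟩
      rw [← LinearEquiv.eq_symm_apply] at h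
      exact h ▸ Submodule.smul_mem _ _ (Submodule.subset_span ⟨_, rfl⟩)
    simpa using key _ hx

theorem barResolution_isFreeResolution :
    (barResolution R G).IsFreeResolution (barAct : Representation R G (BarModule R G)) where
  act_chainMap := barAct_isChainMap
  free k := ⟨_, mem_span_barVertexOne k,
    Module.Free.of_basis (Module.Basis.span (barVertexOne_linearIndependent k))⟩
  exact k x hx hd := ⟨barPhi x, barPhi_mem _ x hx, by
    change barD x = 0 at hd
    change barD (barPhi x) = x
    rw [barD_barPhi, hd, barAug_of_mem k x hx]
    simp⟩
  augmentation := by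
    refine ⟨barAug, barAug_of_mem, barAug_act, fun r => ⟨r • bar 1 [], ?_⟩, fun x hx => ⟨?_, ?_⟩⟩
    · rw [map_smul, barAug_bar_eq]; simp
    · intro h
      refine ⟨barPhi x, barPhi_mem _ x hx, ?_⟩
      change barD (barPhi x) = x
      rw [barD_barPhi, h, barD_zero x hx]
      simp
    · rintro ⟨y, -, rfl⟩
      exact barAug_barD y

end BarFree

/-! ## The operad structure -/

section Cartan

open DGModule

/-- The compositions of `𝔖`: the cross product followed by the map that is induced by the
composition of permutations. -/
def cartanComp : Compositions RS := fun n m _ h i =>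
  barMap (blockMul h i) ∘ₗ barCross ℤ (Equiv.Perm (Fin n)) (Equiv.Perm (Fin m))

theorem cartanComp_circ {n m N : ℕ+} (h : (N : ℕ) + 1 = n + m) (i : Fin m) (a : (RS n).carrier)
    (b : (RS m).carrier) :
    cartanComp.circ h i a b = barMap (blockMul h i) (barCross ℤ _ _ (a ⊗ₜ b)) := rfl

/-- Naturality moves induced maps out of the cross product. Iterated compositions become a single
`barMap` applied to an iterated cross product, and the remaining identity concerns maps of sets
only. -/
theorem cartanComp_circ_barMap {G H : Type} [Group G] [Group H] {n m N : ℕ+}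
    (h : (N : ℕ) + 1 = n + m) (i : Fin m) (f : G → Equiv.Perm (Fin n)) (f' : H → Equiv.Perm (Fin m))
    (a : BarModule ℤ G) (b : BarModule ℤ H) :
    cartanComp.circ h i (barMap f a) (barMap f' b) =
      barMap (fun v => blockMul h i (f v.1, f' v.2)) (barCross ℤ _ _ (a ⊗ₜ b)) := by
  rw [cartanComp_circ, barCross_barMap, barMap_barMap]
  rfl

theorem cartanComp_circ_barMap_right {H : Type} [Group H] {n m N : ℕ+}
    (h : (N : ℕ) + 1 = n + m) (i : Fin m) (f' : H → Equiv.Perm (Fin m))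
    (a : (RS n).carrier) (b : BarModule ℤ H) :
    cartanComp.circ h i a (barMap f' b) =
      barMap (fun v => blockMul h i (v.1, f' v.2)) (barCross ℤ _ _ (a ⊗ₜ b)) := by
  conv_lhs => rw [← barMap_eq_id (f := fun g => g) (fun _ => rfl) a]
  exact cartanComp_circ_barMap h i _ f' a b

theorem cartanComp_circ_barMap_left {G : Type} [Group G] {n m N : ℕ+}
    (h : (N : ℕ) + 1 = n + m) (i : Fin m) (f : G → Equiv.Perm (Fin n))
    (a : BarModule ℤ G) (b : (RS m).carrier) :
    cartanComp.circ h i (barMap f a) b =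
      barMap (fun v => blockMul h i (f v.1, v.2)) (barCross ℤ _ _ (a ⊗ₜ b)) := by
  conv_lhs => rw [← barMap_eq_id (f := fun g => g) (fun _ => rfl) b]
  exact cartanComp_circ_barMap h i f _ a b

theorem cartanComp_isChainMap {n m N : ℕ+} (h : (N : ℕ) + 1 = n + m) (i : Fin m) :
    IsChainMap ((RS n).tensor (RS m)) (RS N) (cartanComp n m N h i) :=
  (barMap_isChainMap _).comp barCross_isChainMap

theorem cartanComp_isEquivariant : cartanComp.IsEquivariant fun _ => barAct where
  circ_act {n m N} h i σ a b := by
    rw [← barMap_mul_left σ, cartanComp_circ_barMap_right, cartanComp_circ, ← barMap_mul_left,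
      barMap_barMap]
    congr 2
    exact funext fun v => blockMul_mul_right h i v.1 σ v.2
  act_circ {n m N} h i τ a b := by
    rw [← barMap_mul_left τ, cartanComp_circ_barMap_left, cartanComp_circ, ← barMap_mul_left,
      barMap_barMap]
    congr 2
    exact funext fun v => blockMul_mul_left h i τ v.1 v.2

theorem cartanComp_isCartanComposition : IsCartanComposition cartanComp where
  chainMap _ _ _ h i := cartanComp_isChainMap h i
  augmentation h i a b := by
    rw [cartanComp_circ, barAug_barMap, barAug_barCross]
  equivariant := cartanComp_isEquivariant
  circ_mem h i a ha b hb := by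
    rw [mem_barA_iff] at ha hb ⊢
    have := barCone_h_barMap (f := blockMul h i) (barCone_h_barCross ha hb)
    -- Elements over `1` compose to elements over `blockMul h i (1, 1) = 1`.
    rwa [blockMul_one] at this

/-- The composition of elements over `g` and `k` is an element over the composition of `g`
and `k`. -/
theorem IsCartanComposition.barCone_h_circ {c : Compositions RS} (hc : IsCartanComposition c)
    {n m N : ℕ+} (h : (N : ℕ) + 1 = n + m) (i : Fin m) (g : Equiv.Perm (Fin n))
    (k : Equiv.Perm (Fin m)) (l : List (Equiv.Perm (Fin n))) (l' : List (Equiv.Perm (Fin m))) :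
    (barCone (blockMul h i (g, k))).h (c.circ h i (bar g l) (bar k l')) = 0 := by
  have h1 : (bar g l : (RS n).carrier) = barAct g (bar 1 l) := by rw [barAct_bar, mul_one]
  have h2 : (bar k l' : (RS m).carrier) = barAct k (bar 1 l') := by rw [barAct_bar, mul_one]
  -- Equivariance moves the index along `k`, so it is applied at `k⁻¹ i` to arrive at `i`. This is
  -- where the inverse in the definition of `blockMul` comes from.
  have h3 := hc.equivariant.circ_act h (k⁻¹ i) k (bar 1 l) (bar 1 l')
  rw [show k (k⁻¹ i) = i from k.apply_symm_apply i] at h3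
  have h4 : (barCone 1).h (c.circ h (k⁻¹ i) (bar 1 l) (bar 1 l')) = 0 :=
    (mem_barA_iff _).1 <| hc.circ_mem h _ _ (Submodule.subset_span ⟨l, rfl⟩) _
      (Submodule.subset_span ⟨l', rfl⟩)
  have h5 := barCone_h_barMap (f := (blockMul h i (g, k) * ·)) h4
  rw [mul_one, barMap_mul_left] at h5
  rw [blockMul, map_mul, Module.End.mul_apply] at h5
  rw [h1, h2, hc.equivariant.act_circ, h3]
  exact h5

/-- On generators the values of both families are killed by the same cones, which depend only on the
permutations, and the augmentations agree. -/
theorem IsCartanComposition.eq_cartanComp {c : Compositions RS} (hc : IsCartanComposition c) :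
    c = cartanComp := by
  funext n m N h i
  refine (barBasis_generates.tensor barBasis_generates).chainMap_unique
    (C := (RS n).tensor (RS m)) (D := RS N)
    (fun v => barCone (blockMul h i (v.1.1, v.2.1))) (hc.chainMap n m N h i)
    (cartanComp_isChainMap h i) ?_ ?_ ?_
  · rintro ⟨v, w⟩
    rw [barBasis_apply, barBasis_apply]
    exact hc.barCone_h_circ h i v.1 w.1 v.2.1 w.2.1
  · rintro ⟨v, w⟩
    rw [barBasis_apply, barBasis_apply]
    exact cartanComp_isCartanComposition.barCone_h_circ h i v.1 w.1 v.2.1 w.2.1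
  · rintro ⟨v, w⟩ -
    exact (hc.augmentation h i _ _).trans (cartanComp_isCartanComposition.augmentation h i _ _).symm

theorem operadS_isOperad : (operadS cartanComp).IsOperad where
  free _ := inferInstance
  act_chainMap _ σ := barAct_isChainMap σ
  unit_mem := bar_mem_barGr _ _ fun _ => rfl
  comp_chainMap _ _ _ h i := cartanComp_isChainMap h i
  assoc {n m t nm mt N} h₁ h₂ h₃ h₄ i j l hl a b c := by
    obtain rfl : l = innerPos h₃ j i := Fin.ext (by rw [hl, innerPos_val, add_comm])
    change cartanComp.circ h₂ j (cartanComp.circ h₁ i a b) c =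
      cartanComp.circ h₄ _ a (cartanComp.circ h₃ j b c)
    rw [cartanComp_circ h₁, cartanComp_circ h₃, cartanComp_circ_barMap_left,
      cartanComp_circ_barMap_right, ← barCross_assoc, barMap_barMap]
    congr 2
    exact funext fun v => blockMul_assoc h₁ h₂ h₃ h₄ i j v.1.1 v.1.2 v.2
  comm {n m t nt mt N} h₁ h₂ h₃ h₄ i j hji l hl j' hj' p q a ha b hb c := by
    have hlt : (j : ℕ) < i := hji
    -- Since `j < i`, substituting `m` positions at `j` shifts `i` to `i + m - 1`, while
    -- substituting at `i` leaves `j` unchanged.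
    obtain rfl : l = outerPos h₁ j i hji.ne' := Fin.ext (by
      rw [outerPos_val, if_neg (by omega)]; omega)
    obtain rfl : j' = outerPos h₃ i j hji.ne := Fin.ext (by
      rw [outerPos_val, if_pos hlt, hj'])
    change cartanComp.circ h₂ _ a (cartanComp.circ h₁ j b c) =
      (-1 : ℤ) ^ (p * q) • cartanComp.circ h₄ _ b (cartanComp.circ h₃ i a c)
    rw [cartanComp_circ h₁, cartanComp_circ h₃, cartanComp_circ_barMap_right,
      cartanComp_circ_barMap_right, barCross_leftComm ha hb, map_smul, barMap_barMap]
    congr 3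
    exact funext fun v => blockMul_comm h₁ h₂ h₃ h₄ i j hji.ne' v.2.1 v.1 v.2.2
  equivariant := cartanComp_isEquivariant
  unit_circ h i b :=
    barCross_vertex_left 1 (fun σ => blockMul_one_left rfl h i σ) b
  circ_unit h i a :=
    barCross_vertex_right 1 (fun τ => blockMul_one_right rfl h i τ) a

theorem barCoprod_vertex {R G : Type} [CommRing R] [Group G] (g : G) :
    barCoprod (bar g [] : BarModule R G) = bar g [] ⊗ₜ bar g [] := by
  simp [barCoprod_bar]

theorem barCoprod_barAct {R G : Type} [CommRing R] [Group G] (g : G) (x : BarModule R G) :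
    barCoprod (barAct g x) = TensorProduct.map (barAct g) (barAct g) (barCoprod x) := by
  rw [← barMap_mul_left]
  exact LinearMap.congr_fun (barCoprod_barMap (g * ·)) x

/-- The coproduct passes through both halves of the composition: through the induced map by
naturality, and through the cross product by `barCoprod_barCross`, which supplies the interchange
sign. -/
theorem barCoprod_circ {n m N : ℕ+} (h : (N : ℕ) + 1 = n + m) (i : Fin m) (a : (RS n).carrier)
    (b : (RS m).carrier) : barCoprod (cartanComp.circ h i a b) =
      TensorProduct.map (cartanComp n m N h i) (cartanComp n m N h i)
        (interchange (RS n) (RS n) (RS m) (RS m) (barCoprod a ⊗ₜ barCoprod b)) := by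
  rw [cartanComp_circ]
  refine (LinearMap.congr_fun (barCoprod_barMap (blockMul h i)) _).trans ?_
  rw [LinearMap.comp_apply, barCoprod_barCross, ← LinearMap.comp_apply, ← TensorProduct.map_comp]
  rfl

theorem operadS_isOperadCoproduct : (operadS cartanComp).IsOperadCoproduct fun _ => barCoprod where
  left :=
    { chainMap := fun _ => barCoprod_isChainMap
      map_act := fun _ σ x => barCoprod_barAct σ x
      map_unit := barCoprod_vertex 1
      map_circ := fun h i a b => barCoprod_circ h i a b }
  right _ x := barCoprod_coassoc x

end Cartan

/-- The bar resolutions of the symmetric groups carry a unique family of augmentation-preserving,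
equivariant compositions that respect the subgroups `A(S_n, 1)`; they form an `E_∞`-operad, which is
an operad-coalgebra. -/
theorem mainTheorem10 :
    ∃ c : Compositions RS,
      IsCartanComposition c ∧ (∀ c' : Compositions RS, IsCartanComposition c' → c' = c) ∧
      (operadS c).IsEInfinity ∧
      (operadS c).IsOperadCoproduct (fun _ => barCoprod) :=
  ⟨cartanComp, cartanComp_isCartanComposition, fun _ hc => hc.eq_cartanComp,
    ⟨operadS_isOperad, fun _ => barResolution_isFreeResolution⟩, operadS_isOperadCoproduct⟩

end
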